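/- Let $\mathbb S^3$ be the group of unit quaternions with its round metric, the left invariant orthonormal frame $E_1=i$, $E_2=j$, $E_3=k$ at the identity, and the orientation given by this frame. Let $\Sigma$ be a simply connected Lorentz surface, i.e. a surface with an atlas of proper null coordinates $(u,v)$, the coordinate changes being smooth and locally of the form $(u,v)\mapsto(a(u),b(v))$ with $a'b'>0$; and let $g:\Sigma\to\mathbb C\cup\{\infty\}$ be smooth. For an immersion $\psi:\Sigma\to\mathbb S^3$ let $N$ be the unit normal such that $(\psi_u,\psi_v,N)$ is positively oriented. The Gauss map of $\psi$ is $\frac{N_1+iN_2}{1-N_3}$, where $\psi^{-1}N=N_1E_1+N_2E_2+N_3E_3$; the extrinsic curvature $K$ is the determinant of the shape operator; and the Lorentz structure of $\Sigma$ is the one induced by the second fundamental form $II=\langle -dN,d\psi\rangle$ if $II=2f\,du\,dv$ with $f>0$ in all proper null coordinates. (1) There is a smooth (isometric, for the pulled back metric) immersion $\psi:\Sigma\to\mathbb S^3$ with Gauss map $g$ and negative extrinsic curvature nowhere equal to $-1$, such that the Lorentz structure of $\Sigma$ is the one induced by the second fundamental form, if and only if there is a smooth negative function $K:\Sigma\to\mathbb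 R\setminus\{-1\}$ such that in all proper null coordinates $$(1+K)\; i\,(g_u\bar g_v-\bar g_u g_v)<0$$ (that is, $i(g_u\bar g_v-\bar g_ug_v)>0$ if $K<-1$, and $i(g_u\bar g_v-\bar g_ug_v)<0$ if $-1<K<0$) and $$\Big(\log\tfrac{(1+\sqrt{-K})^4}{-K}\Big)_u=\frac{4}{\bar g_ug_v-g_u\bar g_v}\Big(\bar g_ug_{uv}-g_u\bar g_{uv}+2|g_u|^2\,\frac{g\bar g_v-\bar gg_v}{1+|g|^2}\Big),$$ $$\Big(\log\tfrac{(-1+\sqrt{-K})^4}{-K}\Big)_v=-\frac{4}{\bar g_ug_v-g_u\bar g_v}\Big(\bar g_vg_{uv}-g_v\bar g_{uv}+2|g_v|^2\,\frac{g\bar g_u-\bar gg_u}{1+|g|^2}\Big).$$ At points where $g=\infty$ these conditions are imposed on $1/g$ instead of $g$ (where both $g$ and $1/g$ are finite the conditions for the two are equivalent). (2) More precisely, for each function $K:\Sigma\to(-\infty,0)\setminus\{-1\}$ there is such an immersion with extrinsic curvature $K$ if and only if $K$ is smooth and satisfies these conditions; and it is unique up to left translations: if $\psi_1,\psi_2$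 are two such immersions with the same $g$ and $K$, then $\psi_2=a\,\psi_1$ for some $a\in\mathbb S^3$. -/

import Mathlib

open scoped Manifold ContDiff Quaternion ComplexConjugate Topology

noncomputable section

namespace LorentzGauss

/-- The unit sphere of the quaternions, a group under quaternion multiplication.  Its left invariant
orthonormal frame is `E₁(q) = q i`, `E₂(q) = q j`, `E₃(q) = q k`, with `[E₁, E₂] = 2 E₃`,
`[E₂, E₃] = 2 E₁`, `[E₃, E₁] = 2 E₂`; the sphere is oriented by this frame. -/
abbrev S3 : Type := Metric.sphere (0 : ℍ[ℝ]) 1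

section Derivatives

variable {F : Type*} [NormedAddCommGroup F] [NormedSpace ℝ F]

/-- Partial derivative in the first null coordinate `u`. -/
def du (f : ℝ × ℝ → F) (x : ℝ × ℝ) : F := fderiv ℝ f x (1, 0)

/-- Partial derivative in the second null coordinate `v`. -/
def dv (f : ℝ × ℝ → F) (x : ℝ × ℝ) : F := fderiv ℝ f x (0, 1)

end Derivatives

/-- A Lorentz surface, given by an atlas of proper null coordinates `(u, v)`: the transition maps
are smooth and locally of the form `(u, v) ↦ (a u, b v)` with `a' b' > 0`.  Such an atlas is the same
thing as an orientation together with a class of Lorentzian metrics up to positive factors,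
represented by `2 du dv` in every chart. -/
class LorentzSurface (S : Type*) [TopologicalSpace S] [ChartedSpace (ℝ × ℝ) S] : Prop
    extends IsManifold 𝓘(ℝ, ℝ × ℝ) ∞ S where
  null_transition : ∀ e ∈ atlas (ℝ × ℝ) S, ∀ e' ∈ atlas (ℝ × ℝ) S, ∀ x ∈ (e.symm.trans e').source,
    (dv (e.symm.trans e') x).1 = 0 ∧ (du (e.symm.trans e') x).2 = 0 ∧
      0 < (du (e.symm.trans e') x).1 * (dv (e.symm.trans e') x).2

section Forms

/-- First fundamental form of a parametrized surface `Ψ` with values in `S3 ⊆ ℍ = ℝ⁴`. -/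
def firstForm (Ψ : ℝ × ℝ → ℍ[ℝ]) (x X Y : ℝ × ℝ) : ℝ :=
  inner ℝ (fderiv ℝ Ψ x X) (fderiv ℝ Ψ x Y)

/-- Second fundamental form `⟨-∇_X N, dΨ(Y)⟩` of `Ψ` for the normal field `N`.  The Levi-Civita
derivative in `S3` is the tangential part of the derivative in `ℝ⁴`, and `dΨ(Y)` is tangent to `S3`,
so the ambient derivative gives the same inner product. -/
def secondForm (Ψ N : ℝ × ℝ → ℍ[ℝ]) (x X Y : ℝ × ℝ) : ℝ :=
  inner ℝ (-(fderiv ℝ N x X)) (fderiv ℝ Ψ x Y)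

/-- Determinant of a bilinear form in the basis `∂_u, ∂_v`. -/
def formDet (b : ℝ × ℝ → ℝ × ℝ → ℝ) : ℝ :=
  b (1, 0) (1, 0) * b (0, 1) (0, 1) - b (1, 0) (0, 1) * b (0, 1) (1, 0)

/-- Extrinsic curvature: the determinant `det II / det I` of the shape operator. -/
def extrinsicCurvature (Ψ N : ℝ × ℝ → ℍ[ℝ]) (x : ℝ × ℝ) : ℝ :=
  formDet (secondForm Ψ N x) / formDet (firstForm Ψ x)

/-- Determinant of three vectors of the Lie algebra (imaginary quaternions) in the basis `i, j, k`. -/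
def imDet (a b c : ℍ[ℝ]) : ℝ :=
  Matrix.det !![a.imI, a.imJ, a.imK; b.imI, b.imJ, b.imK; c.imI, c.imJ, c.imK]

end Forms

/-- Stereographic projection from the north pole of the unit sphere of imaginary quaternions. -/
def stereo (n : ℍ[ℝ]) : OnePoint ℂ :=
  open Classical in
  if n.imK = 1 then OnePoint.infty
  else (((n.imI + Complex.I * n.imJ) / (1 - n.imK) : ℂ) : OnePoint ℂ)

/-- The holomorphic coordinate of the Riemann sphere used near `c`: it is `z` if `c ≠ ∞`, and `1/z`
(with value `0` at `∞`) if `c = ∞`. -/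
def sphereCoord (c z : OnePoint ℂ) : ℂ :=
  c.elim (z.elim 0 fun t => t⁻¹) fun _ => z.elim 0 id

section Surfaces

variable {S : Type*} [TopologicalSpace S] [ChartedSpace (ℝ × ℝ) S]

/-- Smooth maps into the Riemann sphere. -/
def SmoothToSphere (g : S → OnePoint ℂ) : Prop :=
  Continuous g ∧
    ∀ p, ContMDiffAt 𝓘(ℝ, ℝ × ℝ) 𝓘(ℝ, ℂ) ∞ (fun q => sphereCoord (g p) (g q)) p

/-- Gauss map of the immersion `ψ` with unit normal `N`: the stereographic projection of the left
translate `ψ(p)⁻¹ N(p)` of the normal to the Lie algebra. -/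
def gaussMap (ψ : S → S3) (N : S → ℍ[ℝ]) (p : S) : OnePoint ℂ :=
  stereo ((ψ p : ℍ[ℝ])⁻¹ * N p)

/-- `ψ` is a smooth immersion into `S3`, and `N` is a smooth unit normal field of `ψ`. -/
structure IsImmersionWithNormal (ψ : S → S3) (N : S → ℍ[ℝ]) : Prop where
  smooth : ContMDiff 𝓘(ℝ, ℝ × ℝ) 𝓘(ℝ, ℍ[ℝ]) ∞ fun p => (ψ p : ℍ[ℝ])
  immersion : ∀ p, Function.Injective
    (mfderiv 𝓘(ℝ, ℝ × ℝ) 𝓘(ℝ, ℍ[ℝ]) (fun q => (ψ q : ℍ[ℝ])) p)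
  normal_smooth : ContMDiff 𝓘(ℝ, ℝ × ℝ) 𝓘(ℝ, ℍ[ℝ]) ∞ N
  normal_unit : ∀ p, ‖N p‖ = 1
  normal_tangent : ∀ p, inner ℝ (ψ p : ℍ[ℝ]) (N p) = 0
  normal_orthogonal : ∀ e ∈ atlas (ℝ × ℝ) S, ∀ p ∈ e.source, ∀ X : ℝ × ℝ,
    inner ℝ (N p) (fderiv ℝ (fun x => (ψ (e.symm x) : ℍ[ℝ])) (e p) X) = 0

/-- The Lorentz structure of `S` is the one induced by the second fundamental form: in all proper
null coordinates `II = 2 f du dv` with `f > 0`, where `N` is the unit normal for which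
`(ψ_u, ψ_v, N)` is a positive basis of the tangent space of `S3`. -/
def InducesLorentzStructure (ψ : S → S3) (N : S → ℍ[ℝ]) : Prop :=
  ∀ e ∈ atlas (ℝ × ℝ) S, ∀ p ∈ e.source,
    let Ψ : ℝ × ℝ → ℍ[ℝ] := fun x => (ψ (e.symm x) : ℍ[ℝ])
    let II := secondForm Ψ (fun x => N (e.symm x)) (e p)
    II (1, 0) (1, 0) = 0 ∧ II (0, 1) (0, 1) = 0 ∧ 0 < II (1, 0) (0, 1) ∧
      0 < imDet ((ψ p : ℍ[ℝ])⁻¹ * du Ψ (e p)) ((ψ p : ℍ[ℝ])⁻¹ * dv Ψ (e p))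
        ((ψ p : ℍ[ℝ])⁻¹ * N p)

/-- `ψ` is an immersion into `S3` with Gauss map `g` and extrinsic curvature `K` whose second
fundamental form induces the Lorentz structure of `S`. -/
def IsRealization (g : S → OnePoint ℂ) (K : S → ℝ) (ψ : S → S3) : Prop :=
  ∃ N : S → ℍ[ℝ], IsImmersionWithNormal ψ N ∧ InducesLorentzStructure ψ N ∧
    (∀ p, gaussMap ψ N p = g p) ∧
    ∀ e ∈ atlas (ℝ × ℝ) S, ∀ p ∈ e.source,
      extrinsicCurvature (fun x => (ψ (e.symm x) : ℍ[ℝ])) (fun x => N (e.symm x)) (e p) = K p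

/-- The real number `i (w_u w̄_v - w̄_u w_v)`. -/
def gaussJacobian (w : ℝ × ℝ → ℂ) (x : ℝ × ℝ) : ℝ :=
  (Complex.I * (du w x * conj (dv w x) - conj (du w x) * dv w x)).re

/-- First integrability equation, for `w` and the function `k` of `(u, v)`, at the point `x`. -/
def IntegrabilityU (w : ℝ × ℝ → ℂ) (k : ℝ × ℝ → ℝ) (x : ℝ × ℝ) : Prop :=
  ((du (fun y => Real.log ((1 + √(-k y)) ^ 4 / (-k y))) x : ℝ) : ℂ) =
    4 / (conj (du w x) * dv w x - du w x * conj (dv w x)) *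
      (conj (du w x) * dv (du w) x - du w x * conj (dv (du w) x) +
        2 * (‖du w x‖ : ℂ) ^ 2 * ((w x * conj (dv w x) - conj (w x) * dv w x) /
          (1 + (‖w x‖ : ℂ) ^ 2)))

/-- Second integrability equation, for `w` and the function `k` of `(u, v)`, at the point `x`. -/
def IntegrabilityV (w : ℝ × ℝ → ℂ) (k : ℝ × ℝ → ℝ) (x : ℝ × ℝ) : Prop :=
  ((dv (fun y => Real.log ((-1 + √(-k y)) ^ 4 / (-k y))) x : ℝ) : ℂ) =
    -(4 / (conj (du w x) * dv w x - du w x * conj (dv w x))) *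
      (conj (dv w x) * dv (du w) x - dv w x * conj (dv (du w) x) +
        2 * (‖dv w x‖ : ℂ) ^ 2 * ((w x * conj (du w x) - conj (w x) * du w x) /
          (1 + (‖w x‖ : ℂ) ^ 2)))

/-- The sign condition on `g` and `K`, in all proper null coordinates (with `1/g` in place of `g`
where `g = ∞`). -/
def SignCondition (g : S → OnePoint ℂ) (K : S → ℝ) : Prop :=
  ∀ e ∈ atlas (ℝ × ℝ) S, ∀ p ∈ e.source,
    (1 + K p) * gaussJacobian (fun x => sphereCoord (g p) (g (e.symm x))) (e p) < 0

/-- `K` solves the integrability system for `g`, in all proper null coordinates (with `1/g` in place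
of `g` where `g = ∞`). -/
def SolvesIntegrability (g : S → OnePoint ℂ) (K : S → ℝ) : Prop :=
  ∀ e ∈ atlas (ℝ × ℝ) S, ∀ p ∈ e.source,
    IntegrabilityU (fun x => sphereCoord (g p) (g (e.symm x))) (fun x => K (e.symm x)) (e p) ∧
    IntegrabilityV (fun x => sphereCoord (g p) (g (e.symm x))) (fun x => K (e.symm x)) (e p)

end Surfaces

end LorentzGauss

end

noncomputable section

open Set Filter

/-! ### Local integration of a flat connection form. -/

section Frobenius

/-! Write `n = ψ⁻¹ N`, `a = ψ⁻¹ ψ_u`, `b = ψ⁻¹ ψ_v`: imaginary quaternions, with `a` and `b`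
orthogonal to the unit vector `n`. Differentiating `N = ψ n` gives `ψ⁻¹ N_u = a n + n_u`, and right
multiplication by `n` is a quarter turn of the plane orthogonal to `n`. In asymptotic coordinates
the shape operator turns each coordinate direction by a quarter turn and scales it by `s` or `-s`,
where `s = √(-K)`. Hence `n_u n = (1 - s) a` and `n_v n = (1 + s) b` (`exists_structure_equation`).
Since `s ≠ 1`, this can be solved for the Maurer-Cartan form: `dψ = ψ θ` with `θ = (1 - s)⁻¹ n_u n
du + (1 + s)⁻¹ n_v n dv`. Thus `g` and `K` determine `θ`, and `ψ` is determined up to a left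
translation.

Conversely, every unit solution of `dψ = ψ θ` has the normal `ψ n` and curvature `-s²`, and its
asymptotic lines are the coordinate lines. It is an immersion with the right orientation exactly
when `det (n_u, n_v, n)` has the sign of `1 - s² = 1 + K` (`IsParallelAt.geometry`). As
stereographic projection from the north pole reverses orientation, this is the stated sign
condition.

Solutions exist locally iff `θ` is flat. The curvature of `θ` is a nonzero multiple of `T n`, where
`T` is the tangential part of `n_uv` minus a combination of `n_u` and `n_v` whose coefficients are
logarithmic derivatives of functions of `s` (`IsGaussData.curvature_connForm`). In a stereographic
coordinate `w`, the equation `T = 0` becomes one complex equation. Its imaginary parts after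
multiplication by the conjugates of `w_u` and `w_v` are the two integrability equations
(`integrability_iff_tensionDefect`).

Local solutions come from a Frobenius theorem (`exists_parallel_section`). Any two differ by a
locally constant left factor, so they glue over a simply connected surface
(`exists_global_section`). The structure equation does not depend on the null chart
(`IsParallelAt.comp_null`), and a rotation of the sphere treats the points where `g = ∞`. -/

theorem norm_le_of_norm_deriv_le_norm_add {F : Type*} [NormedAddCommGroup F] [NormedSpace ℝ F]
    {f f' : ℝ → F} {δ ε : ℝ} (hδ : 0 ≤ δ) (hε : 0 ≤ ε)
    (hf : ∀ t ∈ Icc (0 : ℝ) 1, HasDerivWithinAt f (f' t) (Icc 0 1) t)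
    (h0 : ‖f 0‖ ≤ δ) (hb : ∀ t ∈ Icc (0 : ℝ) 1, ‖f' t‖ ≤ ‖f t‖ + ε) :
    ∀ t ∈ Icc (0 : ℝ) 1, ‖f t‖ ≤ 3 * (δ + ε) := by
  intro t ht
  have h := norm_le_gronwallBound_of_norm_deriv_right_le (f := f) (f' := f') (δ := δ) (K := 1)
    (ε := ε) (a := 0) (b := 1) (fun t ht => (hf t ht).continuousWithinAt)
    (fun t ht => (hf t ⟨ht.1, ht.2.le⟩).mono_of_mem_nhdsWithin (Icc_mem_nhdsGE_of_mem ht)) h0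
    (fun t ht => by simpa using hb t ⟨ht.1, ht.2.le⟩) t ht
  refine h.trans ?_
  rw [gronwallBound_of_K_ne_0 one_ne_zero]
  -- Over unit time with rate `1`, Gronwall gives `δ e + ε (e - 1)`, and `e < 3`.
  have h1 : Real.exp (1 * (t - 0)) ≤ 3 := by
    refine (Real.exp_le_exp.2 (by simpa using ht.2)).trans (Real.exp_one_lt_d9.le.trans (by norm_num))
  simp only [div_one]
  nlinarith [Real.exp_pos (1 * (t - 0))]

variable {E 𝔸 : Type*} [NormedAddCommGroup E] [NormedSpace ℝ E] [NormedRing 𝔸] [NormedAlgebra ℝ 𝔸]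
  [NormOneClass 𝔸] [CompleteSpace 𝔸]

/-- Parallel transport along the unit interval for a connection form with small coefficient. -/
theorem exists_transport {a : ℝ → 𝔸} (ha : ContinuousOn a (Icc 0 1))
    (hb : ∀ t ∈ Icc (0 : ℝ) 1, ‖a t‖ ≤ 1 / 2) :
    ∃ f : ℝ → 𝔸, f 0 = 1 ∧
      ∀ t ∈ Icc (0 : ℝ) 1, HasDerivWithinAt f (f t * a t) (Icc 0 1) t := by
  -- On the closed unit ball around `1` the solution has norm at most `2`, so the vector field is
  -- bounded by `2 * (1 / 2) = 1`; this lets the solution live for the whole unit time.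
  have hpl : IsPicardLindelof (fun t x => x * a t) (tmin := 0) (tmax := 1)
      ⟨0, by simp⟩ (1 : 𝔸) 1 0 1 1 := by
    constructor
    · intro t ht
      refine LipschitzOnWith.of_dist_le_mul fun x _ y _ => ?_
      rw [dist_eq_norm, ← sub_mul, dist_eq_norm]
      refine (norm_mul_le _ _).trans ?_
      have := hb t ht
      have := norm_nonneg (x - y)
      simp only [NNReal.coe_one]
      nlinarith
    · intro x _
      exact continuousOn_const.mul ha
    · intro t ht x hx
      have h1 : ‖x‖ ≤ 2 := by
        have h2 : ‖x - 1‖ ≤ 1 := by simpa [dist_eq_norm] using hx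
        calc ‖x‖ = ‖(x - 1) + 1‖ := by simp
          _ ≤ ‖x - 1‖ + ‖(1 : 𝔸)‖ := norm_add_le _ _
          _ ≤ 2 := by rw [norm_one]; linarith
      refine (norm_mul_le _ _).trans ?_
      have := hb t ht
      have := norm_nonneg (a t)
      simp only [NNReal.coe_one]
      nlinarith
    · simp
  obtain ⟨f, h0, hf⟩ := hpl.exists_eq_forall_mem_Icc_hasDerivWithinAt₀
  exact ⟨f, h0, hf⟩

open Metric in
/-- Local Frobenius theorem for a flat connection form with values in a Banach algebra, at `0`. -/
theorem exists_parallel_section_zero {θ : E → E →L[ℝ] 𝔸} (hθ : ContDiffAt ℝ 2 θ 0)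
    (hflat : ∀ᶠ x in 𝓝 (0 : E), ∀ y z, fderiv ℝ θ x z y - fderiv ℝ θ x y z =
      θ x y * θ x z - θ x z * θ x y) :
    ∃ φ : E → 𝔸, φ 0 = 1 ∧
      ∀ᶠ x in 𝓝 (0 : E), HasFDerivAt φ ((ContinuousLinearMap.mul ℝ 𝔸 (φ x)).comp (θ x)) x := by
  have hd : ContDiffAt ℝ 1 (fderiv ℝ θ) 0 := hθ.fderiv_right (by norm_num)
  obtain ⟨L₂, t, ht, hL₂⟩ := hd.exists_lipschitzOnWith
  have hdiff : ∀ᶠ x in 𝓝 (0 : E), DifferentiableAt ℝ θ x :=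
    (hθ.eventually (by simp)).mono fun x hx => hx.differentiableAt (by simp)
  obtain ⟨M, hM0, hM⟩ : ∃ M : ℝ, 0 < M ∧ ∀ᶠ x in 𝓝 (0 : E), ‖θ x‖ ≤ M :=
    ⟨‖θ 0‖ + 1, by positivity, (hθ.continuousAt.norm.eventually_lt_const
      (lt_add_one _)).mono fun x hx => hx.le⟩
  obtain ⟨L₁, hL₁0, hL₁⟩ : ∃ L : ℝ, 0 ≤ L ∧ ∀ᶠ x in 𝓝 (0 : E), ‖fderiv ℝ θ x‖ ≤ L :=
    ⟨‖fderiv ℝ θ 0‖ + 1, by positivity, ((ContinuousAt.norm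
      (f := fderiv ℝ θ) hd.continuousAt).eventually_lt_const (lt_add_one _)).mono fun x hx => hx.le⟩
  obtain ⟨R, hR0, hR⟩ := Metric.eventually_nhds_iff_ball.1
    ((((show ∀ᶠ x in 𝓝 (0 : E), x ∈ t from ht).and hdiff).and hM).and (hL₁.and hflat))
  -- The bound `M * ρ ≤ 1 / 2` is what `exists_transport` requires along every ray in the ball.
  obtain ⟨ρ, hρ0, hρR, hρM⟩ : ∃ ρ : ℝ, 0 < ρ ∧ ρ ≤ R ∧ M * ρ ≤ 1 / 2 := by
    refine ⟨min R (1 / (2 * M)), by positivity, min_le_left _ _, ?_⟩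
    calc M * min R (1 / (2 * M)) ≤ M * (1 / (2 * M)) := by gcongr; exact min_le_right _ _
      _ = 1 / 2 := by field_simp
  have hB : ∀ x ∈ ball (0 : E) ρ, x ∈ ball (0 : E) R := ball_subset_ball hρR
  have hseg : ∀ x ∈ ball (0 : E) ρ, ∀ s ∈ Icc (0 : ℝ) 1, s • x ∈ ball (0 : E) ρ := by
    intro x hx s hs
    rw [mem_ball_zero_iff] at hx ⊢
    rw [norm_smul, Real.norm_of_nonneg hs.1]
    exact (mul_le_of_le_one_left (norm_nonneg _) hs.2).trans_lt hx
  have hcoef : ∀ x ∈ ball (0 : E) ρ, ∀ s ∈ Icc (0 : ℝ) 1, ‖θ (s • x) x‖ ≤ 1 / 2 := by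
    intro x hx s hs
    have h1 := (hR _ (hB _ (hseg x hx s hs))).1.2
    rw [mem_ball_zero_iff] at hx
    calc ‖θ (s • x) x‖ ≤ ‖θ (s • x)‖ * ‖x‖ := ContinuousLinearMap.le_opNorm _ _
      _ ≤ M * ρ := by gcongr
      _ ≤ 1 / 2 := hρM
  have hcont : ∀ x ∈ ball (0 : E) ρ, ContinuousOn (fun s : ℝ => θ (s • x) x) (Icc 0 1) := by
    intro x hx s hs
    have h1 : ContinuousAt θ (s • x) := (hR _ (hB _ (hseg x hx s hs))).1.1.2.continuousAt
    have h2 : ContinuousAt (fun s : ℝ => θ (s • x)) s :=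
      ContinuousAt.comp (f := fun s : ℝ => s • x) h1 (by fun_prop)
    exact (h2.clm_apply continuousAt_const).continuousWithinAt
  -- Parallel transport along the ray `s ↦ s • x`; outside the ball the constant `1` is a dummy
  -- value that makes the choice total. The section is the transport evaluated at `s = 1`.
  have hex : ∀ x : E, ∃ f : ℝ → 𝔸, f 0 = 1 ∧ (x ∈ ball (0 : E) ρ → ∀ s ∈ Icc (0 : ℝ) 1,
      HasDerivWithinAt f (f s * θ (s • x) x) (Icc 0 1) s) := by
    intro x
    by_cases hx : x ∈ ball (0 : E) ρ
    · obtain ⟨f, h0, hf⟩ := exists_transport (hcont x hx) (hcoef x hx)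
      exact ⟨f, h0, fun _ => hf⟩
    · exact ⟨fun _ => 1, rfl, fun h => (hx h).elim⟩
  choose F hF0 hF using hex
  have hFb : ∀ x ∈ ball (0 : E) ρ, ∀ s ∈ Icc (0 : ℝ) 1, ‖F x s‖ ≤ 3 := by
    intro x hx
    have := norm_le_of_norm_deriv_le_norm_add (f := F x) (δ := 1) (ε := 0) zero_le_one le_rfl
      (hF x hx) (by rw [hF0, norm_one]) (fun s hs => by
        refine (norm_mul_le _ _).trans ?_
        have := hcoef x hx s hs
        have := norm_nonneg (F x s)
        nlinarith)
    simpa using this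
  -- Taylor estimates for the connection form
  have hT1 : ∀ x ∈ ball (0 : E) ρ, ∀ z ∈ ball (0 : E) ρ, ‖θ z - θ x‖ ≤ L₁ * ‖z - x‖ :=
    fun x hx z hz => (convex_ball (0 : E) ρ).norm_image_sub_le_of_norm_fderiv_le
      (fun y hy => (hR y (hB y hy)).1.1.2) (fun y hy => (hR y (hB y hy)).2.1) hx hz
  have hT2 : ∀ x ∈ ball (0 : E) ρ, ∀ z ∈ ball (0 : E) ρ,
      ‖θ z - θ x - fderiv ℝ θ x (z - x)‖ ≤ L₂ * ‖z - x‖ * ‖z - x‖ := by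
    intro x hx z hz
    refine (convex_segment x z).norm_image_sub_le_of_norm_hasFDerivWithin_le'
      (f' := fderiv ℝ θ) (fun y hy => ?_) (fun y hy => ?_) (left_mem_segment ℝ x z)
      (right_mem_segment ℝ x z)
    · exact (hR y (hB y ((convex_ball (0 : E) ρ).segment_subset hx hz
        hy))).1.1.2.hasFDerivAt.hasFDerivWithinAt
    · have hy' := (convex_ball (0 : E) ρ).segment_subset hx hz hy
      have h1 := hL₂.dist_le_mul y (hR y (hB y hy')).1.1.1 x (hR x (hB x hx)).1.1.1
      rw [dist_eq_norm, dist_eq_norm] at h1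
      refine h1.trans ?_
      gcongr
      exact norm_sub_le_of_mem_segment hy
  refine ⟨fun x => F x 1, ?_, ?_⟩
  · have h0 := norm_le_of_norm_deriv_le_norm_add (f := fun s => F 0 s - 1)
      (f' := fun s => F 0 s * θ (s • 0) 0) (δ := 0) (ε := 0) le_rfl le_rfl
      (fun s hs => (hF 0 (mem_ball_self hρ0) s hs).sub_const 1) (by simp [hF0]) (by simp) 1 (by simp)
    simpa [sub_eq_zero] using h0
  filter_upwards [ball_mem_nhds (0 : E) hρ0] with x hx
  set C₁ : ℝ := L₁ * ρ + M with hC₁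
  have hC₁0 : 0 ≤ C₁ := by positivity
  -- the coefficient along nearby rays
  have hco : ∀ z ∈ ball (0 : E) ρ, ∀ s ∈ Icc (0 : ℝ) 1,
      ‖θ (s • z) z - θ (s • x) x‖ ≤ C₁ * ‖z - x‖ := by
    intro z hz s hs
    have e : θ (s • z) z - θ (s • x) x = (θ (s • z) - θ (s • x)) x + θ (s • z) (z - x) := by
      simp only [sub_apply, map_sub]; abel
    have h1 := hT1 _ (hseg x hx s hs) _ (hseg z hz s hs)
    rw [← smul_sub, norm_smul, Real.norm_of_nonneg hs.1] at h1
    have h2 : L₁ * (s * ‖z - x‖) ≤ L₁ * ‖z - x‖ := by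
      gcongr; exact mul_le_of_le_one_left (norm_nonneg _) hs.2
    rw [e]
    refine (norm_add_le _ _).trans ?_
    have h3 := (hR _ (hB _ (hseg z hz s hs))).1.2
    have hx' := (mem_ball_zero_iff.1 hx).le
    calc _ ≤ ‖θ (s • z) - θ (s • x)‖ * ‖x‖ + ‖θ (s • z)‖ * ‖z - x‖ :=
          add_le_add (ContinuousLinearMap.le_opNorm _ _) (ContinuousLinearMap.le_opNorm _ _)
      _ ≤ (L₁ * ‖z - x‖) * ρ + M * ‖z - x‖ := by gcongr; exact h1.trans h2
      _ = C₁ * ‖z - x‖ := by rw [hC₁]; ring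
  have hlip : ∀ z ∈ ball (0 : E) ρ, ∀ s ∈ Icc (0 : ℝ) 1,
      ‖F z s - F x s‖ ≤ 9 * C₁ * ‖z - x‖ := by
    intro z hz s hs
    have := norm_le_of_norm_deriv_le_norm_add (f := fun s => F z s - F x s)
      (δ := 0) (ε := 3 * (C₁ * ‖z - x‖)) le_rfl (by positivity)
      (fun s hs => (hF z hz s hs).sub (hF x hx s hs)) (by simp [hF0]) (fun s hs => ?_) s hs
    · refine this.trans (le_of_eq (by ring))
    · have e : F z s * θ (s • z) z - F x s * θ (s • x) x =
          (F z s - F x s) * θ (s • z) z + F x s * (θ (s • z) z - θ (s • x) x) := by noncomm_ring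
      rw [e]
      refine (norm_add_le _ _).trans (add_le_add ?_ ?_)
      · refine (norm_mul_le _ _).trans ?_
        have := hcoef z hz s hs
        have := norm_nonneg (F z s - F x s)
        nlinarith
      · refine (norm_mul_le _ _).trans ?_
        gcongr
        · exact hFb x hx s hs
        · exact hco z hz s hs
  set C : ℝ := 9 * C₁ * C₁ + 3 * (L₂ * ρ + L₁) with hC
  have hC0 : 0 ≤ C := by positivity
  -- The expected variation of the transport in the direction `y = z - x` is `s • (F x s * θ (s • x)
  -- y)`. The error in this guess vanishes at `s = 0` and solves the transport equation up to an
  -- inhomogeneity of order `‖y‖²`, so Gronwall makes it quadratic at `s = 1`.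
  have hquad : ∀ z ∈ ball (0 : E) ρ,
      ‖F z 1 - F x 1 - F x 1 * θ x (z - x)‖ ≤ 3 * C * (‖z - x‖ * ‖z - x‖) := by
    intro z hz
    set y := z - x with hy
    have hzy : z = x + y := by rw [hy]; abel
    have hder : ∀ s ∈ Icc (0 : ℝ) 1, HasDerivWithinAt
        (fun s => F z s - F x s - s • (F x s * θ (s • x) y))
        (F z s * θ (s • z) z - F x s * θ (s • x) x -
          (s • (F x s * θ (s • x) x * θ (s • x) y + F x s * fderiv ℝ θ (s • x) x y) +
            (1 : ℝ) • (F x s * θ (s • x) y))) (Icc 0 1) s := by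
      intro s hs
      have h1 : HasDerivAt (fun s : ℝ => θ (s • x)) (fderiv ℝ θ (s • x) x) s := by
        have h2 := (hR _ (hB _ (hseg x hx s hs))).1.1.2.hasFDerivAt
        have h3 : HasDerivAt (fun s : ℝ => s • x) x s := by
          simpa using (hasDerivAt_id s).smul_const x
        exact h2.comp_hasDerivAt s h3
      have h4 : HasDerivAt (fun s : ℝ => θ (s • x) y) (fderiv ℝ θ (s • x) x y) s := by
        simpa using h1.clm_apply (hasDerivAt_const s y)
      exact ((hF z hz s hs).sub (hF x hx s hs)).sub
        ((hasDerivWithinAt_id s _).smul ((hF x hx s hs).mul h4.hasDerivWithinAt))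
    have := norm_le_of_norm_deriv_le_norm_add (δ := 0) (ε := C * (‖y‖ * ‖y‖)) le_rfl
      (by positivity) hder (by simp [hF0]) (fun s hs => ?_) 1 (by simp)
    · simp only [one_smul, zero_add] at this
      refine this.trans (le_of_eq (by ring))
    · have hfl := (hR _ (hB _ (hseg x hx s hs))).2.2 y x
      have e : F z s * θ (s • z) z - F x s * θ (s • x) x -
          (s • (F x s * θ (s • x) x * θ (s • x) y + F x s * fderiv ℝ θ (s • x) x y) +
            (1 : ℝ) • (F x s * θ (s • x) y)) =
          (F z s - F x s - s • (F x s * θ (s • x) y)) * θ (s • x) x +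
          ((F z s - F x s) * (θ (s • z) z - θ (s • x) x) +
           F x s * ((θ (s • z) - θ (s • x) - fderiv ℝ θ (s • x) (s • z - s • x)) x +
              (θ (s • z) - θ (s • x)) y)) := by
        -- The only use of flatness: it exchanges the two arguments of the derivative of `θ`, which
        -- cancels the terms linear in `y`.
        have hfl' : fderiv ℝ θ (s • x) x y = fderiv ℝ θ (s • x) y x +
            (θ (s • x) y * θ (s • x) x - θ (s • x) x * θ (s • x) y) := by rw [← hfl]; abel
        rw [hfl', ← smul_sub, ← hy]
        have hz2 : θ (s • z) z = θ (s • z) x + θ (s • z) y := by rw [hzy, map_add]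
        rw [hz2]
        simp only [sub_apply, map_smul, smul_apply, one_smul,
          mul_add, mul_sub, sub_mul, smul_add, smul_sub, smul_mul_assoc, mul_smul_comm,
          mul_assoc]
        abel
      rw [e]
      refine (norm_add_le _ _).trans (add_le_add ?_ ?_)
      · refine (norm_mul_le _ _).trans ?_
        have := hcoef x hx s hs
        have := norm_nonneg (F z s - F x s - s • (F x s * θ (s • x) y))
        nlinarith
      · have hs1 : ‖s • z - s • x‖ ≤ ‖y‖ := by
          rw [← smul_sub, norm_smul, Real.norm_of_nonneg hs.1]
          exact mul_le_of_le_one_left (norm_nonneg _) hs.2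
        have b1 : ‖(F z s - F x s) * (θ (s • z) z - θ (s • x) x)‖ ≤
            (9 * C₁ * ‖y‖) * (C₁ * ‖y‖) := by
          refine (norm_mul_le _ _).trans ?_
          gcongr
          · exact hlip z hz s hs
          · exact hco z hz s hs
        have b2 : ‖(θ (s • z) - θ (s • x) - fderiv ℝ θ (s • x) (s • z - s • x)) x‖ ≤
            (L₂ * ‖y‖ * ‖y‖) * ρ := by
          refine (ContinuousLinearMap.le_opNorm _ _).trans ?_
          gcongr
          · refine (hT2 _ (hseg x hx s hs) _ (hseg z hz s hs)).trans ?_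
            gcongr
          · exact (mem_ball_zero_iff.1 hx).le
        have b3 : ‖(θ (s • z) - θ (s • x)) y‖ ≤ (L₁ * ‖y‖) * ‖y‖ := by
          refine (ContinuousLinearMap.le_opNorm _ _).trans ?_
          gcongr
          refine (hT1 _ (hseg x hx s hs) _ (hseg z hz s hs)).trans ?_
          gcongr
        have b4 : ‖F x s * ((θ (s • z) - θ (s • x) - fderiv ℝ θ (s • x) (s • z - s • x)) x +
              (θ (s • z) - θ (s • x)) y)‖ ≤ 3 * ((L₂ * ‖y‖ * ‖y‖) * ρ + (L₁ * ‖y‖) * ‖y‖) := by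
          refine (norm_mul_le _ _).trans ?_
          gcongr
          · exact hFb x hx s hs
          · exact (norm_add_le _ _).trans (add_le_add b2 b3)
        refine (norm_add_le _ _).trans ((add_le_add b1 b4).trans (le_of_eq ?_))
        rw [hC]; ring
  rw [hasFDerivAt_iff_isLittleO]
  have hO : (fun z => F z 1 - F x 1 - ((ContinuousLinearMap.mul ℝ 𝔸 (F x 1)).comp (θ x)) (z - x))
      =O[𝓝 x] fun z => ‖z - x‖ * ‖z - x‖ := by
    refine Asymptotics.IsBigO.of_bound (3 * C) ?_
    filter_upwards [isOpen_ball.mem_nhds hx] with z hz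
    simpa using hquad z hz
  refine hO.trans_isLittleO ?_
  have h1 : (fun z : E => ‖z - x‖) =o[𝓝 x] fun _ => (1 : ℝ) := by
    rw [Asymptotics.isLittleO_one_iff]
    have : ContinuousAt (fun z : E => ‖z - x‖) x := by fun_prop
    simpa [ContinuousAt] using this
  have h2 := h1.mul_isBigO (Asymptotics.isBigO_refl (fun z : E => ‖z - x‖) (𝓝 x))
  simpa using h2.norm_right

/-- Local Frobenius theorem for a flat connection form with values in a Banach algebra. -/
theorem exists_parallel_section {θ : E → E →L[ℝ] 𝔸} {p : E} (hθ : ContDiffAt ℝ 2 θ p)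
    (hflat : ∀ᶠ x in 𝓝 p, ∀ y z, fderiv ℝ θ x z y - fderiv ℝ θ x y z =
      θ x y * θ x z - θ x z * θ x y) :
    ∃ φ : E → 𝔸, φ p = 1 ∧
      ∀ᶠ x in 𝓝 p, HasFDerivAt φ ((ContinuousLinearMap.mul ℝ 𝔸 (φ x)).comp (θ x)) x := by
  have ht : Tendsto (fun x => p + x) (𝓝 0) (𝓝 p) := by
    have : ContinuousAt (fun x => p + x) (0 : E) := by fun_prop
    simpa [ContinuousAt] using this
  have ht' : Tendsto (fun x => x - p) (𝓝 p) (𝓝 0) := by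
    have : ContinuousAt (fun x => x - p) p := by fun_prop
    simpa [ContinuousAt] using this
  obtain ⟨φ, h0, hφ⟩ := exists_parallel_section_zero (θ := fun x => θ (p + x))
    (ContDiffAt.comp (0 : E) (f := fun x => p + x) (by simpa using hθ)
      (contDiffAt_const.add contDiffAt_id)) (by
      filter_upwards [ht.eventually hflat] with x hx y z
      rw [fderiv_comp_add_left]
      exact hx y z)
  refine ⟨fun x => φ (x - p), by simpa using h0, ?_⟩
  filter_upwards [ht'.eventually hφ] with x hx
  have := hx.comp x ((hasFDerivAt_id x).sub_const p)
  simpa [Function.comp_def] using this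

end Frobenius
end

noncomputable section

open Set Filter

/-! ### Gluing of local sections over a simply connected space. -/

section Monodromy

/-- On a simply connected space, local sections with values in a group that differ by locally
constant left factors can be corrected by locally constant left factors to a global section. -/
theorem exists_global_section {X ι G : Type*} [TopologicalSpace X] [SimplyConnectedSpace X]
    [LocallyPathConnectedSpace X] [Group G] (V : ι → Set X) (hV : ∀ i, IsOpen (V i))
    (hcov : ∀ x, ∃ i, x ∈ V i) (φ : ι → X → G)
    (h : ∀ i j, ∀ x ∈ V i ∩ V j, ∀ᶠ y in 𝓝 x, φ i y * (φ j y)⁻¹ = φ i x * (φ j x)⁻¹) :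
    ∃ ψ : X → G, ∀ i, ∀ x ∈ V i, ∀ᶠ y in 𝓝 x, ψ y * (φ i y)⁻¹ = ψ x * (φ i x)⁻¹ := by
  let _ : TopologicalSpace G := ⊥
  have : DiscreteTopology G := ⟨rfl⟩
  choose idx hidx using hcov
  let Z : FiberBundleCore ι X G :=
    { baseSet := V
      isOpen_baseSet := hV
      indexAt := idx
      mem_baseSet_at := hidx
      -- The coordinate `c` over `V i` stands for the corrected section `c * φ i`; equality of `c *
      -- φ i` and `c' * φ j` at `x` gives this transition rule.
      coordChange := fun i j x c => c * (φ i x * (φ j x)⁻¹)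
      coordChange_self := fun i x _ c => by simp
      continuousOn_coordChange := by
        rintro i j ⟨x, c⟩ hx
        have hc : ∀ᶠ y : X × G in 𝓝 (x, c), y.2 * (φ i y.1 * (φ j y.1)⁻¹) =
            c * (φ i x * (φ j x)⁻¹) := by
          rw [nhds_prod_eq, nhds_discrete G]
          have := (h i j x hx.1).prod_mk (show ∀ᶠ d in pure c, d = c by simp)
          filter_upwards [this] with y hy
          rw [hy.1, hy.2]
        exact (continuousAt_const.congr (hc.mono fun y hy => hy.symm)).continuousWithinAt
      coordChange_comp := fun i j k x _ c => by group }
  have hcover : IsCoveringMap Z.proj := FiberBundle.isCoveringMap (F := G) (E := Z.Fiber)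
  obtain ⟨x₀⟩ : Nonempty X := inferInstance
  -- Simple connectedness lifts the identity map, which is a global section of the covering.
  obtain ⟨σ, ⟨-, hσ⟩, -⟩ := hcover.existsUnique_continuousMap_lifts (ContinuousMap.id X) x₀
    (⟨x₀, (1 : G)⟩ : Z.TotalSpace) rfl
  have hproj : ∀ x, (σ x).1 = x := fun x => congrFun hσ x
  let ψ : X → G := fun x => (show G from (σ x).2) * φ (idx (σ x).1) (σ x).1
  refine ⟨ψ, fun i x hx => ?_⟩
  have hval : ∀ y, (Z.localTriv i (σ y)).2 = ψ y * (φ i y)⁻¹ := by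
    intro y
    change (show G from (σ y).2) * (φ (idx (σ y).1) (σ y).1 * (φ i (σ y).1)⁻¹) = _
    rw [← mul_assoc]
    conv_lhs => rw [hproj y]
    simp only [ψ, hproj y]
  have hct : ContinuousAt (fun y => (Z.localTriv i (σ y)).2) x := by
    have h1 : ContinuousAt (Z.localTriv i) (σ x) := by
      refine (Z.localTriv i).continuousOn.continuousAt ((Z.localTriv i).open_source.mem_nhds ?_)
      rw [(Z.localTriv i).mem_source]
      change (σ x).1 ∈ V i
      rw [hproj]; exact hx
    exact (h1.comp σ.continuous.continuousAt).snd
  have := hct.eventually (p := fun c => c = ψ x * (φ i x)⁻¹) (by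
    rw [nhds_discrete]; exact eventually_pure.2 (hval x))
  filter_upwards [this] with y hy
  rw [← hy, hval]

end Monodromy
end

noncomputable section

open Set Filter

namespace LorentzGauss

/-! ### Imaginary quaternions, determinants and the pointwise Weingarten equations. -/

section QuaternionAlgebra

theorem inner_eq_components (a b : ℍ[ℝ]) : inner ℝ a b =
    a.re * b.re + a.imI * b.imI + a.imJ * b.imJ + a.imK * b.imK := by
  rw [Quaternion.inner_def]; simp

theorem norm_eq_one_iff_inner {a : ℍ[ℝ]} : ‖a‖ = 1 ↔ inner ℝ a a = (1 : ℝ) := by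
  rw [real_inner_self_eq_norm_sq, pow_eq_one_iff_of_nonneg (norm_nonneg a) two_ne_zero]

theorem star_mul_self_of_norm_one {q : ℍ[ℝ]} (hq : ‖q‖ = 1) : star q * q = 1 := by
  rw [Quaternion.star_mul_self, Quaternion.normSq_eq_norm_mul_self, hq]; simp

theorem inv_eq_star_of_norm_one {q : ℍ[ℝ]} (hq : ‖q‖ = 1) : q⁻¹ = star q :=
  inv_eq_of_mul_eq_one_left (star_mul_self_of_norm_one hq)

theorem inner_mul_mul_of_norm_one {q : ℍ[ℝ]} (hq : ‖q‖ = 1) (a b : ℍ[ℝ]) :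
    inner ℝ (q * a) (q * b) = (inner ℝ a b : ℝ) := by
  have h := norm_eq_one_iff_inner.1 hq
  rw [inner_eq_components] at h
  simp only [inner_eq_components, Quaternion.re_mul, Quaternion.imI_mul, Quaternion.imJ_mul,
    Quaternion.imK_mul]
  linear_combination (a.re * b.re + a.imI * b.imI + a.imJ * b.imJ + a.imK * b.imK) * h

theorem mul_eq_neg_mul_of_inner_eq_zero {a b : ℍ[ℝ]} (ha : a.re = 0) (hb : b.re = 0)
    (hab : inner ℝ a b = (0 : ℝ)) : a * b = -(b * a) := by
  rw [inner_eq_components, ha, hb] at hab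
  ext <;> simp [ha, hb] <;> linarith

theorem re_mul_of_re_eq_zero {a b : ℍ[ℝ]} (ha : a.re = 0) :
    (a * b).re = -(inner ℝ a b : ℝ) := by
  rw [inner_eq_components]; simp [ha]; ring

theorem mul_self_of_re_eq_zero {a : ℍ[ℝ]} (ha : a.re = 0) :
    a * a = ((-(inner ℝ a a : ℝ) : ℝ) : ℍ[ℝ]) := by
  rw [inner_eq_components]
  ext <;> simp [ha] <;> ring

theorem mul_self_of_unit {n : ℍ[ℝ]} (hn : n.re = 0) (h1 : inner ℝ n n = (1 : ℝ)) :
    n * n = -1 := by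
  rw [mul_self_of_re_eq_zero hn, h1]; simp

/-- The determinant is the scalar triple product, that is, minus the real part of the quaternion
product. In this form it can be manipulated by associativity and anticommutation. -/
theorem imDet_eq {a b c : ℍ[ℝ]} (ha : a.re = 0) (hb : b.re = 0) (hc : c.re = 0) :
    imDet a b c = -(a * b * c).re := by
  simp [imDet, Matrix.det_fin_three, ha, hb, hc]
  ring

theorem imDet_smul_smul (s t : ℝ) (a b c : ℍ[ℝ]) :
    imDet (s • a) (t • b) c = s * t * imDet a b c := by
  simp [imDet, Matrix.det_fin_three]; ring

/-- This is the Gram determinant of `a`, `b`, `n` with `n` a unit vector orthogonal to the other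
two; it identifies `det I` with a square. -/
theorem imDet_sq {a b n : ℍ[ℝ]} (ha : a.re = 0) (hb : b.re = 0) (hn : n.re = 0)
    (h1 : inner ℝ n n = (1 : ℝ)) (han : inner ℝ a n = (0 : ℝ)) (hbn : inner ℝ b n = (0 : ℝ)) :
    imDet a b n ^ 2 = (inner ℝ a a : ℝ) * inner ℝ b b - inner ℝ a b * inner ℝ b a := by
  have key : imDet a b n ^ 2 = (inner ℝ a a : ℝ) * inner ℝ b b * inner ℝ n n +
      2 * inner ℝ a b * inner ℝ b n * inner ℝ a n - inner ℝ a a * (inner ℝ b n) ^ 2 -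
      inner ℝ b b * (inner ℝ a n) ^ 2 - inner ℝ n n * (inner ℝ a b) ^ 2 := by
    simp only [inner_eq_components, imDet, Matrix.det_fin_three, ha, hb, hn]
    simp
    ring
  rw [key, h1, han, hbn, real_inner_comm a b]; ring

/-- Right multiplication by a unit imaginary quaternion rotates its orthogonal plane. -/
theorem imDet_mul_right {a b n : ℍ[ℝ]} (ha : a.re = 0) (hb : b.re = 0) (hn : n.re = 0)
    (h1 : inner ℝ n n = (1 : ℝ)) (han : inner ℝ a n = (0 : ℝ)) (hbn : inner ℝ b n = (0 : ℝ)) :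
    imDet (a * n) (b * n) n = imDet a b n := by
  have hnn := mul_self_of_unit hn h1
  rw [imDet_eq (by rw [re_mul_of_re_eq_zero ha, han, neg_zero])
    (by rw [re_mul_of_re_eq_zero hb, hbn, neg_zero]) hn, imDet_eq ha hb hn]
  have : a * n * (b * n) * n = a * b * n := by
    calc a * n * (b * n) * n = a * n * b * (n * n) := by noncomm_ring
      _ = -(a * (n * b)) := by rw [hnn]; noncomm_ring
      _ = a * b * n := by
        rw [mul_eq_neg_mul_of_inner_eq_zero hn hb (by rw [real_inner_comm]; exact hbn)]
        noncomm_ring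
  rw [this]

theorem inner_mul_right_self {a n : ℍ[ℝ]} (hn : n.re = 0) : inner ℝ (a * n) a = (0 : ℝ) := by
  simp only [inner_eq_components, Quaternion.re_mul, Quaternion.imI_mul, Quaternion.imJ_mul,
    Quaternion.imK_mul, hn]
  ring

theorem inner_mul_right_eq_zero {a n : ℍ[ℝ]} (ha : a.re = 0) :
    inner ℝ (a * n) n = (0 : ℝ) := by
  simp only [inner_eq_components, Quaternion.re_mul, Quaternion.imI_mul, Quaternion.imJ_mul,
    Quaternion.imK_mul, ha]
  ring

/-- The imaginary part of `a * n` is the cross product, so pairing with `b` is a triple product with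
the last two entries exchanged. -/
theorem inner_mul_eq_imDet {a b n : ℍ[ℝ]} (ha : a.re = 0) (hb : b.re = 0) (hn : n.re = 0) :
    inner ℝ (a * n) b = -imDet a b n := by
  simp [inner_eq_components, imDet, Matrix.det_fin_three, ha, hb, hn]
  ring

/-- An imaginary quaternion orthogonal to `n` and to `a` is a multiple of `a * n`, for `a`
orthogonal to the unit `n`. -/
theorem exists_mul_eq_smul {x a n : ℍ[ℝ]} (hx : x.re = 0) (ha : a.re = 0) (hn : n.re = 0)
    (han : inner ℝ a n = (0 : ℝ)) (hxn : inner ℝ x n = (0 : ℝ)) (hxa : inner ℝ x a = (0 : ℝ))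
    (ha0 : a ≠ 0) : ∃ c : ℝ, x * n = c • a := by
  have e1 := mul_eq_neg_mul_of_inner_eq_zero hx hn hxn
  have e2 := mul_eq_neg_mul_of_inner_eq_zero hx ha hxa
  have e3 := mul_eq_neg_mul_of_inner_eq_zero ha hn han
  -- The vectors `x`, `n`, `a` are pairwise orthogonal and imaginary, so they anticommute.
  -- Conjugation then fixes their product, which is therefore real, and one can divide by `a`.
  have hs : star (x * (n * a)) = x * (n * a) := by
    rw [star_mul, star_mul, Quaternion.star_eq_neg.2 hx, Quaternion.star_eq_neg.2 hn,
      Quaternion.star_eq_neg.2 ha]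
    calc -a * -n * -x = -(a * n * x) := by noncomm_ring
      _ = -(n * (x * a)) := by rw [e3, e2]; noncomm_ring
      _ = x * (n * a) := by rw [← mul_assoc x, e1]; noncomm_ring
  obtain ⟨c, hc⟩ : ∃ c : ℝ, x * (n * a) = (c : ℍ[ℝ]) := ⟨_, Quaternion.star_eq_self.1 hs⟩
  have hq : (inner ℝ a a : ℝ) ≠ 0 := inner_self_ne_zero.2 ha0
  refine ⟨-(c / inner ℝ a a), ?_⟩
  have h4 : x * n * (a * a) = c • a := by
    rw [← Quaternion.coe_mul_eq_smul, ← hc]; noncomm_ring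
  rw [mul_self_of_re_eq_zero ha, Quaternion.mul_coe_eq_smul] at h4
  have h5 := congrArg (fun z => (-(inner ℝ a a : ℝ))⁻¹ • z) h4
  simp only [smul_smul] at h5
  rw [inv_mul_cancel₀ (neg_ne_zero.2 hq), one_smul] at h5
  rw [h5]
  congr 1
  rw [inv_neg]; field_simp

/-- The Weingarten equations in asymptotic coordinates with respect to the left translated frame:
`a`, `b` and `n` are the left translates of the coordinate fields and of the normal, `x` and `y` the
derivatives of `n`. -/
theorem exists_asymptotic_weingarten {a b n x y : ℍ[ℝ]} (ha : a.re = 0) (hb : b.re = 0)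
    (hn : n.re = 0) (hx : x.re = 0) (hy : y.re = 0) (h1 : inner ℝ n n = (1 : ℝ))
    (han : inner ℝ a n = (0 : ℝ)) (hbn : inner ℝ b n = (0 : ℝ)) (hxn : inner ℝ x n = (0 : ℝ))
    (hyn : inner ℝ y n = (0 : ℝ)) (hxa : inner ℝ x a = (0 : ℝ)) (hyb : inner ℝ y b = (0 : ℝ))
    (hD : 0 < imDet a b n) {f : ℝ} (hf : 0 < f) (hf₁ : inner ℝ (a * n + x) b = -f)
    (hf₂ : inner ℝ (b * n + y) a = -f) :
    ∃ t : ℝ, 0 < t ∧ f = t * imDet a b n ∧ x * n = (1 - t) • a ∧ y * n = (1 + t) • b := by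
  have ha0 : a ≠ 0 := by rintro rfl; simp [imDet, Matrix.det_fin_three] at hD
  have hb0 : b ≠ 0 := by rintro rfl; simp [imDet, Matrix.det_fin_three] at hD
  obtain ⟨α, hα⟩ := exists_mul_eq_smul hx ha hn han hxn hxa ha0
  obtain ⟨β, hβ⟩ := exists_mul_eq_smul hy hb hn hbn hyn hyb hb0
  have hnn := mul_self_of_unit hn h1
  have back : ∀ {z c : ℍ[ℝ]} {r : ℝ}, z * n = r • c → z = (-r) • (c * n) := by
    intro z c r h
    have : z * (n * n) = r • c * n := by rw [← h]; noncomm_ring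
    rw [hnn, smul_mul_assoc] at this
    rw [neg_smul, ← this]; simp
  have hba : imDet b a n = -imDet a b n := by
    simp [imDet, Matrix.det_fin_three]; ring
  rw [back hα, inner_add_left, inner_smul_left, inner_mul_eq_imDet ha hb hn] at hf₁
  rw [back hβ, inner_add_left, inner_smul_left, inner_mul_eq_imDet hb ha hn, hba] at hf₂
  simp only [conj_trivial] at hf₁ hf₂
  have e1 : f = (1 - α) * imDet a b n := by linarith
  have e2 : f = (β - 1) * imDet a b n := by linarith
  -- Both mixed coefficients of the second fundamental form equal the same `f`; cancelling the
  -- determinant ties `β` to `α`, and `t = 1 - α` is the common parameter, positive because `f` is.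
  have e3 : β = 1 + (1 - α) := by
    have := mul_right_cancel₀ hD.ne' (e1.symm.trans e2)
    linarith
  exact ⟨1 - α, by by_contra! h; nlinarith, e1, by rw [hα]; congr 1; ring, by rw [hβ, e3]⟩

/-- The curvature of the connection form with coefficients `(1 - s)⁻¹ n_u n` and `(1 + s)⁻¹ n_v n`,
in terms of the tension of `n`. -/
theorem curvature_eq {n x y z : ℍ[ℝ]} (hnn : n * n = -1) (hy : n * y = -(y * n))
    (hx : n * x = -(x * n)) {s su sv : ℝ} (hs : s ≠ 0) (hα : 1 - s ≠ 0) (hβ : 1 + s ≠ 0) :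
    ((sv / (1 - s) ^ 2) • (x * n) + (1 - s)⁻¹ • (z * n + x * y)) -
      ((-su / (1 + s) ^ 2) • (y * n) + (1 + s)⁻¹ • (z * n + y * x)) -
      ((1 - s)⁻¹ • (x * n) * ((1 + s)⁻¹ • (y * n)) - (1 + s)⁻¹ • (y * n) * ((1 - s)⁻¹ • (x * n))) =
    (2 * s / ((1 - s) * (1 + s))) • ((z - (1 / 2 : ℝ) • ((x * y + y * x) * n) -
      (-(sv * (1 + s)) / (2 * s * (1 - s))) • x - (-(su * (1 - s)) / (2 * s * (1 + s))) • y) * n) := by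
  have e1 : x * n * (y * n) = x * y := by
    calc x * n * (y * n) = x * (n * y) * n := by noncomm_ring
      _ = -(x * y * (n * n)) := by rw [hy]; noncomm_ring
      _ = x * y := by rw [hnn]; noncomm_ring
  have e2 : y * n * (x * n) = y * x := by
    calc y * n * (x * n) = y * (n * x) * n := by noncomm_ring
      _ = -(y * x * (n * n)) := by rw [hx]; noncomm_ring
      _ = y * x := by rw [hnn]; noncomm_ring
  have e3 : (x * y + y * x) * n * n = -(x * y + y * x) := by rw [mul_assoc, hnn]; simp
  simp only [sub_mul, smul_mul_assoc, mul_smul_comm, e1, e2, e3, smul_smul]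
  match_scalars <;> field_simp <;> ring

/-- Shows that the term `(1 / 2) (x y + y x) n` of `curvature_eq` is `-⟨x, y⟩ n`, so that
subtracting it from `z` adds `⟨x, y⟩ n`. -/
theorem add_mul_swap_of_re_eq_zero {x y : ℍ[ℝ]} (hx : x.re = 0) (hy : y.re = 0) :
    x * y + y * x = ((-2 * (inner ℝ x y : ℝ) : ℝ) : ℍ[ℝ]) := by
  rw [inner_eq_components]
  ext <;> simp [hx, hy] <;> ring

end QuaternionAlgebra

end LorentzGauss
end

noncomputable section

open Set Filter

namespace LorentzGauss

/-! ### First and second derivatives through inverse stereographic projection. -/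

section StereographicCalculus

theorem complex_inner_eq (w z : ℂ) : inner ℝ w z = w.re * z.re + w.im * z.im := by
  rw [Complex.inner]; simp; ring

/-- The unit quaternion `i`. -/
def unitI : ℍ[ℝ] := ⟨0, 1, 0, 0⟩

/-- The unit quaternion `j`. -/
def unitJ : ℍ[ℝ] := ⟨0, 0, 1, 0⟩

/-- The north pole of the sphere of imaginary quaternions. -/
def northPole : ℍ[ℝ] := ⟨0, 0, 0, 1⟩

@[simp] theorem unitI_re : unitI.re = 0 := rfl
@[simp] theorem unitI_imI : unitI.imI = 1 := rfl
@[simp] theorem unitI_imJ : unitI.imJ = 0 := rfl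
@[simp] theorem unitI_imK : unitI.imK = 0 := rfl
@[simp] theorem unitJ_re : unitJ.re = 0 := rfl
@[simp] theorem unitJ_imI : unitJ.imI = 0 := rfl
@[simp] theorem unitJ_imJ : unitJ.imJ = 1 := rfl
@[simp] theorem unitJ_imK : unitJ.imK = 0 := rfl
@[simp] theorem northPole_re : northPole.re = 0 := rfl
@[simp] theorem northPole_imI : northPole.imI = 0 := rfl
@[simp] theorem northPole_imJ : northPole.imJ = 0 := rfl
@[simp] theorem northPole_imK : northPole.imK = 1 := rfl

/-- The embedding of the equatorial plane of the sphere of imaginary quaternions. -/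
def planeEmbedding : ℂ →L[ℝ] ℍ[ℝ] := Complex.reCLM.smulRight unitI + Complex.imCLM.smulRight unitJ

@[simp] theorem planeEmbedding_re (w : ℂ) : (planeEmbedding w).re = 0 := by simp [planeEmbedding]
@[simp] theorem planeEmbedding_imI (w : ℂ) : (planeEmbedding w).imI = w.re := by
  simp [planeEmbedding]
@[simp] theorem planeEmbedding_imJ (w : ℂ) : (planeEmbedding w).imJ = w.im := by
  simp [planeEmbedding]
@[simp] theorem planeEmbedding_imK (w : ℂ) : (planeEmbedding w).imK = 0 := by simp [planeEmbedding]

/-- Inverse of the stereographic projection from the north pole. -/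
def invStereo (w : ℂ) : ℍ[ℝ] :=
  (1 + inner ℝ w w : ℝ)⁻¹ • ((2 : ℝ) • planeEmbedding w + (inner ℝ w w - 1 : ℝ) • northPole)

/-- Derivative of the inverse stereographic projection. -/
def invStereoDeriv (w ζ : ℂ) : ℍ[ℝ] :=
  (1 + inner ℝ w w : ℝ)⁻¹ •
    ((2 : ℝ) • planeEmbedding ζ + (2 * inner ℝ w ζ : ℝ) • (northPole - invStereo w))

theorem one_add_inner_self_pos (w : ℂ) : 0 < 1 + (inner ℝ w w : ℝ) := by
  have : 0 ≤ (inner ℝ w w : ℝ) := real_inner_self_nonneg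
  linarith

@[simp] theorem invStereo_re (w : ℂ) : (invStereo w).re = 0 := by simp [invStereo]

@[simp] theorem invStereo_imI (w : ℂ) :
    (invStereo w).imI = 2 * w.re / (1 + w.re ^ 2 + w.im ^ 2) := by
  rw [invStereo, complex_inner_eq, ← sq, ← sq, ← add_assoc]
  simp [div_eq_inv_mul]

@[simp] theorem invStereo_imJ (w : ℂ) :
    (invStereo w).imJ = 2 * w.im / (1 + w.re ^ 2 + w.im ^ 2) := by
  rw [invStereo, complex_inner_eq, ← sq, ← sq, ← add_assoc]
  simp [div_eq_inv_mul]

@[simp] theorem invStereo_imK (w : ℂ) :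
    (invStereo w).imK = (w.re ^ 2 + w.im ^ 2 - 1) / (1 + w.re ^ 2 + w.im ^ 2) := by
  rw [invStereo, complex_inner_eq, ← sq, ← sq, ← add_assoc]
  simp [div_eq_inv_mul]

@[simp] theorem invStereoDeriv_re (w ζ : ℂ) : (invStereoDeriv w ζ).re = 0 := by
  simp [invStereoDeriv]

@[simp] theorem invStereoDeriv_imI (w ζ : ℂ) : (invStereoDeriv w ζ).imI =
    2 * ζ.re / (1 + w.re ^ 2 + w.im ^ 2) -
      4 * (w.re * ζ.re + w.im * ζ.im) * w.re / (1 + w.re ^ 2 + w.im ^ 2) ^ 2 := by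
  have : 1 + w.re ^ 2 + w.im ^ 2 ≠ 0 := by positivity
  rw [invStereoDeriv, complex_inner_eq, complex_inner_eq, ← sq, ← sq, ← add_assoc]
  simp; field_simp; ring

@[simp] theorem invStereoDeriv_imJ (w ζ : ℂ) : (invStereoDeriv w ζ).imJ =
    2 * ζ.im / (1 + w.re ^ 2 + w.im ^ 2) -
      4 * (w.re * ζ.re + w.im * ζ.im) * w.im / (1 + w.re ^ 2 + w.im ^ 2) ^ 2 := by
  have : 1 + w.re ^ 2 + w.im ^ 2 ≠ 0 := by positivity
  rw [invStereoDeriv, complex_inner_eq, complex_inner_eq, ← sq, ← sq, ← add_assoc]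
  simp; field_simp; ring

@[simp] theorem invStereoDeriv_imK (w ζ : ℂ) : (invStereoDeriv w ζ).imK =
    4 * (w.re * ζ.re + w.im * ζ.im) / (1 + w.re ^ 2 + w.im ^ 2) ^ 2 := by
  have : 1 + w.re ^ 2 + w.im ^ 2 ≠ 0 := by positivity
  rw [invStereoDeriv, complex_inner_eq, complex_inner_eq, ← sq, ← sq, ← add_assoc]
  simp; field_simp; ring

theorem inner_invStereo_self (w : ℂ) : inner ℝ (invStereo w) (invStereo w) = (1 : ℝ) := by
  have : 1 + w.re ^ 2 + w.im ^ 2 ≠ 0 := by positivity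
  simp only [inner_eq_components, invStereo_re, invStereo_imI, invStereo_imJ, invStereo_imK]
  field_simp; ring

theorem invStereoDeriv_add (w ζ ξ : ℂ) :
    invStereoDeriv w (ζ + ξ) = invStereoDeriv w ζ + invStereoDeriv w ξ := by
  simp only [invStereoDeriv, map_add, inner_add_right]; module

theorem invStereoDeriv_smul (w ζ : ℂ) (r : ℝ) :
    invStereoDeriv w (r • ζ) = r • invStereoDeriv w ζ := by
  simp only [invStereoDeriv, map_smul, inner_smul_right]; module

/-- The `k` component determines the inner product of `w` with the tangent vector, after which the
other two components give the vector. This brings vanishing statements on the sphere back to `ℂ`. -/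
theorem invStereoDeriv_injective (w : ℂ) : Function.Injective (invStereoDeriv w) := by
  intro ζ ξ h
  have hr : 1 + w.re ^ 2 + w.im ^ 2 ≠ 0 := by positivity
  simp only [Quaternion.ext_iff, invStereoDeriv_imI, invStereoDeriv_imJ, invStereoDeriv_imK] at h
  obtain ⟨-, h1, h2, h3⟩ := h
  have h4 : w.re * ζ.re + w.im * ζ.im = w.re * ξ.re + w.im * ξ.im := by
    field_simp at h3; linarith
  rw [h4] at h1 h2
  apply Complex.ext
  · have : 2 * ζ.re / (1 + w.re ^ 2 + w.im ^ 2) = 2 * ξ.re / (1 + w.re ^ 2 + w.im ^ 2) := by linarith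
    field_simp at this; linarith
  · have : 2 * ζ.im / (1 + w.re ^ 2 + w.im ^ 2) = 2 * ξ.im / (1 + w.re ^ 2 + w.im ^ 2) := by linarith
    field_simp at this; linarith

/-- Conformal factor squared times the planar area form; the minus sign is the reversal of
orientation by projection from the north pole. -/
theorem imDet_invStereoDeriv (w ζ ξ : ℂ) :
    imDet (invStereoDeriv w ζ) (invStereoDeriv w ξ) (invStereo w) =
      -(4 / (1 + w.re ^ 2 + w.im ^ 2) ^ 2) * (ζ.re * ξ.im - ζ.im * ξ.re) := by
  have : 1 + w.re ^ 2 + w.im ^ 2 ≠ 0 := by positivity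
  simp [imDet, Matrix.det_fin_three]
  field_simp
  ring

variable {E : Type*} [NormedAddCommGroup E] [NormedSpace ℝ E]

theorem contDiff_invStereo : ContDiff ℝ ∞ invStereo := by
  unfold invStereo
  refine ContDiff.smul (ContDiff.inv ?_ fun w => (one_add_inner_self_pos w).ne') ?_
  · exact contDiff_const.add (contDiff_id.inner ℝ contDiff_id)
  · exact (planeEmbedding.contDiff.const_smul _).add
      (((contDiff_id.inner ℝ contDiff_id).sub contDiff_const).smul contDiff_const)

/-- Differentiates the denominator-free relation `(1 + |w|²) n = 2 w + (|w|² - 1) k`, where `w` is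
viewed in the equatorial plane and `k` is the north pole, and solves for the derivative of `n`. -/
theorem fderiv_invStereo_comp {w : E → ℂ} {x : E} (hw : DifferentiableAt ℝ w x) (X : E) :
    fderiv ℝ (fun y => invStereo (w y)) x X = invStereoDeriv (w x) (fderiv ℝ w x X) := by
  have hn : DifferentiableAt ℝ (fun y => invStereo (w y)) x :=
    (contDiff_invStereo.differentiable (by simp) _).comp x hw
  have e : (fun y => (1 + inner ℝ (w y) (w y) : ℝ) • invStereo (w y)) =
      fun y => (2 : ℝ) • planeEmbedding (w y) + (inner ℝ (w y) (w y) - 1 : ℝ) • northPole := by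
    funext y
    rw [invStereo, smul_inv_smul₀ (one_add_inner_self_pos _).ne']
  have hi : HasFDerivAt (fun y => (inner ℝ (w y) (w y) : ℝ)) _ x :=
    hw.hasFDerivAt.inner ℝ hw.hasFDerivAt
  have h1 := (hi.const_add 1).smul hn.hasFDerivAt
  have h2 := ((planeEmbedding.hasFDerivAt.comp x hw.hasFDerivAt).const_smul (2 : ℝ)).add
    ((hi.sub_const 1).smul_const northPole)
  have h3 := h1.unique (h2.congr_of_eventuallyEq (Eventually.of_forall (congrFun e)))
  have h4 := congrArg (fun L => L X) h3
  simp [fderivInnerCLM_apply] at h4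
  rw [invStereoDeriv, eq_inv_smul_iff₀ (one_add_inner_self_pos _).ne', smul_sub,
    ← add_sub_assoc, eq_sub_iff_add_eq, real_inner_self_eq_norm_sq]
  simp only [complex_inner_eq]
  linear_combination (norm := module) h4

/-- The same implicit differentiation, applied to the first derivative after multiplication by `1 +
|w|²`. -/
theorem fderiv_fderiv_invStereo_comp {w : E → ℂ} {x : E} (hw : ContDiffAt ℝ ∞ w x) (X Y : E) :
    fderiv ℝ (fun y => fderiv ℝ (fun y => invStereo (w y)) y X) x Y =
      (1 + inner ℝ (w x) (w x) : ℝ)⁻¹ •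
        ((2 : ℝ) • planeEmbedding (fderiv ℝ (fun y => fderiv ℝ w y X) x Y) +
          (2 * (inner ℝ (fderiv ℝ w x Y) (fderiv ℝ w x X) +
            inner ℝ (w x) (fderiv ℝ (fun y => fderiv ℝ w y X) x Y)) : ℝ) •
              (northPole - invStereo (w x)) -
          (2 * inner ℝ (w x) (fderiv ℝ w x X) : ℝ) • invStereoDeriv (w x) (fderiv ℝ w x Y) -
          (2 * inner ℝ (w x) (fderiv ℝ w x Y) : ℝ) • invStereoDeriv (w x) (fderiv ℝ w x X)) := by
  have hev : ∀ᶠ y in 𝓝 x, DifferentiableAt ℝ w y :=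
    (hw.of_le (m := 1) (by simp) |>.eventually (by simp)).mono
      fun y hy => hy.differentiableAt (by simp)
  have hd := hw.differentiableAt (by simp)
  have hn : ContDiffAt ℝ ∞ (fun y => invStereo (w y)) x := contDiff_invStereo.contDiffAt.comp x hw
  have hn1 : DifferentiableAt ℝ (fun y => fderiv ℝ (fun y => invStereo (w y)) y X) x :=
    ((hn.fderiv_right (m := ∞) (by simp)).clm_apply contDiffAt_const).differentiableAt (by simp)
  have hw1 : DifferentiableAt ℝ (fun y => fderiv ℝ w y X) x :=
    ((hw.fderiv_right (m := ∞) (by simp)).clm_apply contDiffAt_const).differentiableAt (by simp)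
  have e : (fun y => (1 + inner ℝ (w y) (w y) : ℝ) •
        fderiv ℝ (fun y => invStereo (w y)) y X) =ᶠ[𝓝 x]
      fun y => (2 : ℝ) • planeEmbedding (fderiv ℝ w y X) +
        (2 * inner ℝ (w y) (fderiv ℝ w y X) : ℝ) • (northPole - invStereo (w y)) := by
    filter_upwards [hev] with y hy
    rw [fderiv_invStereo_comp hy, invStereoDeriv, smul_inv_smul₀ (one_add_inner_self_pos _).ne']
  have h1 := ((hd.hasFDerivAt.inner ℝ hd.hasFDerivAt).const_add 1).smul hn1.hasFDerivAt
  have h2 := ((planeEmbedding.hasFDerivAt.comp x hw1.hasFDerivAt).const_smul (2 : ℝ)).add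
    (((hd.hasFDerivAt.inner ℝ hw1.hasFDerivAt).const_mul 2).smul
      ((hn.differentiableAt (by simp)).hasFDerivAt.const_sub northPole))
  have h3 := h1.unique (h2.congr_of_eventuallyEq e)
  have h4 := congrArg (fun L => L Y) h3
  simp [fderivInnerCLM_apply, fderiv_invStereo_comp hd] at h4
  rw [eq_inv_smul_iff₀ (one_add_inner_self_pos _).ne', eq_sub_iff_add_eq, real_inner_self_eq_norm_sq]
  simp only [complex_inner_eq]
  linear_combination (norm := module) h4

/-- The left side is the tangential part of the second derivative of a map into the unit sphere, so
it is the Levi-Civita derivative of the sphere. The correction in `w` is the Christoffel symbol `-2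
w̄ / (1 + |w|²)` of the conformal metric `4 |dw|² / (1 + |w|²)²`. -/
theorem tension_invStereo_comp {w : E → ℂ} {x : E} (hw : ContDiffAt ℝ ∞ w x) (X Y : E) :
    fderiv ℝ (fun y => fderiv ℝ (fun y => invStereo (w y)) y X) x Y +
      (inner ℝ (fderiv ℝ (fun y => invStereo (w y)) x X)
        (fderiv ℝ (fun y => invStereo (w y)) x Y) : ℝ) • invStereo (w x) =
      invStereoDeriv (w x) (fderiv ℝ (fun y => fderiv ℝ w y X) x Y -
        2 * conj (w x) * fderiv ℝ w x X * fderiv ℝ w x Y / (1 + (‖w x‖ : ℂ) ^ 2)) := by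
  have hd := hw.differentiableAt (by simp)
  rw [fderiv_fderiv_invStereo_comp hw, fderiv_invStereo_comp hd, fderiv_invStereo_comp hd]
  generalize fderiv ℝ (fun y => fderiv ℝ w y X) x Y = z
  generalize fderiv ℝ w x X = ζ
  generalize fderiv ℝ w x Y = ξ
  generalize w x = w
  have hr : 1 + w.re ^ 2 + w.im ^ 2 ≠ 0 := by positivity
  have hr' : 1 + (w.re ^ 2 + w.im ^ 2) ≠ 0 := by positivity
  have hc : (1 + (‖w‖ : ℂ) ^ 2) = ((1 + w.re ^ 2 + w.im ^ 2 : ℝ) : ℂ) := by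
    rw [← Complex.ofReal_pow, ← Complex.normSq_eq_norm_sq, Complex.normSq_apply]
    push_cast; ring
  rw [hc]
  obtain ⟨p, hp, hp1, hp2⟩ : ∃ p : ℂ, 2 * conj w * ζ * ξ / ((1 + w.re ^ 2 + w.im ^ 2 : ℝ) : ℂ) = p ∧
      p.re = 2 * (w.re * (ζ.re * ξ.re - ζ.im * ξ.im) + w.im * (ζ.re * ξ.im + ζ.im * ξ.re)) /
        (1 + w.re ^ 2 + w.im ^ 2) ∧
      p.im = 2 * (w.re * (ζ.re * ξ.im + ζ.im * ξ.re) - w.im * (ζ.re * ξ.re - ζ.im * ξ.im)) /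
        (1 + w.re ^ 2 + w.im ^ 2) := by
    refine ⟨_, rfl, ?_, ?_⟩
    · rw [Complex.div_ofReal_re]; congr 1; simp; ring
    · rw [Complex.div_ofReal_im]; congr 1; simp; ring
  rw [hp]
  rw [inner_eq_components]
  simp only [complex_inner_eq]
  ext <;> simp [hp1, hp2] <;> field_simp <;> ring

end StereographicCalculus

end LorentzGauss
end

noncomputable section

open Set Filter

namespace LorentzGauss

/-! ### The integrability system as the vanishing of the tension defect. -/

section Integrability

/-- The left-hand side of the equation equivalent to the
integrability system, for a map `n` into the sphere of imaginary quaternions and a function `s`. -/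
def tensionDefect (n : ℝ × ℝ → ℍ[ℝ]) (s : ℝ × ℝ → ℝ) (x : ℝ × ℝ) : ℍ[ℝ] :=
  dv (du n) x - (1 / 2 : ℝ) • ((du n x * dv n x + dv n x * du n x) * n x) -
    (-(dv s x * (1 + s x)) / (2 * s x * (1 - s x))) • du n x -
    (-(du s x * (1 - s x)) / (2 * s x * (1 + s x))) • dv n x

/-- Every bracket is a number minus its conjugate, so factors of `i` cancel and the right side is
real. Clearing the denominator `Im (ā b)` leaves an equation between imaginary parts, and `ā a =
|a|²` turns the last summand into the Christoffel correction. -/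
theorem ofReal_eq_quotient_iff {a b c w : ℂ} (hab : (conj a * b).im ≠ 0) (U : ℝ) :
    ((4 * U : ℝ) : ℂ) = 4 / (conj a * b - a * conj b) *
      (conj a * c - a * conj c + 2 * (‖a‖ : ℂ) ^ 2 * ((w * conj b - conj w * b) /
        (1 + (‖w‖ : ℂ) ^ 2))) ↔
    (conj a * (c - 2 * conj w * a * b / (1 + (‖w‖ : ℂ) ^ 2) - U * b)).im = 0 := by
  have hr : 1 + ‖w‖ ^ 2 ≠ 0 := by positivity
  have hrc : (1 + (‖w‖ : ℂ) ^ 2) ≠ 0 := by exact_mod_cast hr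
  have e1 : conj a * b - a * conj b = ((2 * (conj a * b).im : ℝ) : ℂ) * Complex.I := by
    apply Complex.ext <;> simp; ring
  have e2 : conj a * c - a * conj c = ((2 * (conj a * c).im : ℝ) : ℂ) * Complex.I := by
    apply Complex.ext <;> simp; ring
  have e3 : w * conj b - conj w * b = ((-(2 * (conj w * b).im) : ℝ) : ℂ) * Complex.I := by
    apply Complex.ext <;> simp; ring
  have e4 : conj a * (c - 2 * conj w * a * b / (1 + (‖w‖ : ℂ) ^ 2) - U * b) =
      conj a * c - ((2 * ‖a‖ ^ 2 / (1 + ‖w‖ ^ 2) : ℝ) : ℂ) * (conj w * b) -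
        (U : ℂ) * (conj a * b) := by
    have h : conj a * a = (‖a‖ : ℂ) ^ 2 := by
      rw [mul_comm, Complex.mul_conj, Complex.normSq_eq_norm_sq]; push_cast; rfl
    push_cast
    field_simp
    rw [mul_sub, mul_sub, ← h]
    field_simp
  rw [e4, e1, e2, e3, Complex.sub_im, Complex.sub_im, Complex.im_ofReal_mul,
    Complex.im_ofReal_mul]
  generalize (conj a * b).im = J at *
  generalize (conj a * c).im = X
  generalize (conj w * b).im = Y
  have hJ : (J : ℂ) ≠ 0 := by exact_mod_cast hab
  have e5 : (4 : ℂ) / (((2 * J : ℝ) : ℂ) * Complex.I) * (((2 * X : ℝ) : ℂ) * Complex.I +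
      2 * (‖a‖ : ℂ) ^ 2 * (((-(2 * Y) : ℝ) : ℂ) * Complex.I / (1 + (‖w‖ : ℂ) ^ 2))) =
      ((4 * (X - 2 * ‖a‖ ^ 2 / (1 + ‖w‖ ^ 2) * Y) / J : ℝ) : ℂ) := by
    push_cast
    field_simp [Complex.I_ne_zero]
    ring
  rw [e5, Complex.ofReal_inj, eq_div_iff hab]
  constructor <;> intro h <;> linarith

/-- The numbers `a` and `b` form a real basis of `ℂ`, and `(a, z) ↦ Im (ā z)` is the nondegenerate
area form. -/
theorem eq_zero_iff_im_conj_mul {a b z : ℂ} (hab : (conj a * b).im ≠ 0) :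
    z = 0 ↔ (conj a * z).im = 0 ∧ (conj b * z).im = 0 := by
  refine ⟨fun h => by simp [h], fun ⟨h1, h2⟩ => ?_⟩
  simp only [Complex.mul_im, Complex.conj_re, Complex.conj_im] at hab h1 h2
  apply Complex.ext
  · refine (mul_eq_zero.1 (?_ : (a.re * b.im + -a.im * b.re) * z.re = 0)).resolve_left hab
    linear_combination b.re * h1 - a.re * h2
  · refine (mul_eq_zero.1 (?_ : (a.re * b.im + -a.im * b.re) * z.im = 0)).resolve_left hab
    linear_combination b.im * h1 - a.im * h2

theorem hasDerivAt_log_pow_div {c s : ℝ} (hs : s ≠ 0) (hc : c + s ≠ 0) :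
    HasDerivAt (fun t => Real.log ((c + t) ^ 4 / t ^ 2)) (2 * (s - c) / (s * (c + s))) s := by
  have h1 : HasDerivAt (fun t => (c + t) ^ 4 / t ^ 2) _ s :=
    (((hasDerivAt_id s).const_add c).pow 4).div ((hasDerivAt_id s).pow 2) (by simpa using hs)
  have h2 := h1.log (by
    have : (c + s) ^ 4 ≠ 0 := pow_ne_zero _ hc
    have : s ^ 2 ≠ 0 := pow_ne_zero _ hs
    exact div_ne_zero ‹_› ‹_›)
  convert h2 using 1
  simp only [id, Pi.pow_apply]
  field_simp
  push_cast
  ring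

/-- Used with `c = 1` in the `u` equation and `c = -1` in the `v` equation; the substitution `s =
√(-k)` turns the denominator into `s²`. -/
theorem fderiv_log_pow_div {E : Type*} [NormedAddCommGroup E] [NormedSpace ℝ E] {k : E → ℝ} {x : E}
    {c : ℝ} (hk : DifferentiableAt ℝ k x) (hneg : ∀ y, k y < 0) (hc : c + √(-k x) ≠ 0) (X : E) :
    fderiv ℝ (fun y => Real.log ((c + √(-k y)) ^ 4 / (-k y))) x X =
      2 * (√(-k x) - c) / (√(-k x) * (c + √(-k x))) * fderiv ℝ (fun y => √(-k y)) x X := by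
  have hpos : 0 < -k x := by linarith [hneg x]
  have hs : √(-k x) ≠ 0 := (Real.sqrt_pos.2 hpos).ne'
  have hd : DifferentiableAt ℝ (fun y => √(-k y)) x := hk.neg.sqrt hpos.ne'
  have e : (fun y => Real.log ((c + √(-k y)) ^ 4 / (-k y))) =
      (fun t => Real.log ((c + t) ^ 4 / t ^ 2)) ∘ fun y => √(-k y) := by
    funext y
    simp only [Function.comp]
    rw [Real.sq_sqrt (by linarith [hneg y])]
  rw [e, ((hasDerivAt_log_pow_div hs hc).comp_hasFDerivAt x hd.hasFDerivAt).fderiv]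
  simp

theorem gaussJacobian_eq (w : ℝ × ℝ → ℂ) (x : ℝ × ℝ) :
    gaussJacobian w x = 2 * (conj (du w x) * dv w x).im := by
  simp [gaussJacobian]; ring

theorem du_invStereo {w : ℝ × ℝ → ℂ} {x : ℝ × ℝ} (hw : DifferentiableAt ℝ w x) :
    du (fun y => invStereo (w y)) x = invStereoDeriv (w x) (du w x) :=
  fderiv_invStereo_comp hw _

theorem dv_invStereo {w : ℝ × ℝ → ℂ} {x : ℝ × ℝ} (hw : DifferentiableAt ℝ w x) :
    dv (fun y => invStereo (w y)) x = invStereoDeriv (w x) (dv w x) :=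
  fderiv_invStereo_comp hw _

theorem imDet_invStereo {w : ℝ × ℝ → ℂ} {x : ℝ × ℝ} (hw : DifferentiableAt ℝ w x) :
    imDet (du (fun y => invStereo (w y)) x) (dv (fun y => invStereo (w y)) x) (invStereo (w x)) =
      -(2 / (1 + (w x).re ^ 2 + (w x).im ^ 2) ^ 2) * gaussJacobian w x := by
  rw [du_invStereo hw, dv_invStereo hw, imDet_invStereoDeriv, gaussJacobian_eq]
  simp; ring

/-- The integrability system says that the tension defect of the Gauss map vanishes. -/
theorem integrability_iff_tensionDefect {w : ℝ × ℝ → ℂ} {k : ℝ × ℝ → ℝ} {x : ℝ × ℝ}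
    (hw : ContDiffAt ℝ ∞ w x) (hk : DifferentiableAt ℝ k x) (hneg : ∀ y, k y < 0) (hk1 : k x ≠ -1)
    (hJ : gaussJacobian w x ≠ 0) :
    (IntegrabilityU w k x ∧ IntegrabilityV w k x) ↔
      tensionDefect (fun y => invStereo (w y)) (fun y => √(-k y)) x = 0 := by
  have hpos : 0 < -k x := by linarith [hneg x]
  have hs : 0 < √(-k x) := Real.sqrt_pos.2 hpos
  have hs1 : √(-k x) ≠ 1 := by
    intro h
    rw [Real.sqrt_eq_one] at h
    exact hk1 (by linarith)
  have hc1 : (1 : ℝ) + √(-k x) ≠ 0 := by positivity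
  have hc2 : (-1 : ℝ) + √(-k x) ≠ 0 := fun h => hs1 (by linarith)
  have hc3 : (1 : ℝ) - √(-k x) ≠ 0 := fun h => hs1 (by linarith)
  have hab : (conj (du w x) * dv w x).im ≠ 0 := by
    rw [gaussJacobian_eq] at hJ; exact right_ne_zero_of_mul hJ
  have hba : (conj (dv w x) * du w x).im ≠ 0 := by
    intro h; apply hab; simp at h ⊢; linarith
  have hd := hw.differentiableAt (by simp)
  -- `P` and `Q` are the coefficients of `n_u` and `n_v` in the tension defect; they turn out to be
  -- a quarter of the logarithmic derivatives in the system.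
  set P := -(dv (fun y => √(-k y)) x * (1 + √(-k x))) / (2 * √(-k x) * (1 - √(-k x))) with hP
  set Q := -(du (fun y => √(-k y)) x * (1 - √(-k x))) / (2 * √(-k x) * (1 + √(-k x))) with hQ
  have hU : du (fun y => Real.log ((1 + √(-k y)) ^ 4 / (-k y))) x = 4 * Q := by
    rw [hQ, du, fderiv_log_pow_div hk hneg hc1, du]
    field_simp; ring
  have hV : dv (fun y => Real.log ((-1 + √(-k y)) ^ 4 / (-k y))) x = 4 * P := by
    rw [hP, dv, fderiv_log_pow_div hk hneg hc2, dv]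
    field_simp; ring
  have hten : tensionDefect (fun y => invStereo (w y)) (fun y => √(-k y)) x =
      invStereoDeriv (w x) (dv (du w) x - 2 * conj (w x) * du w x * dv w x /
        (1 + (‖w x‖ : ℂ) ^ 2) + (-P) • du w x + (-Q) • dv w x) := by
    rw [invStereoDeriv_add, invStereoDeriv_add, invStereoDeriv_smul, invStereoDeriv_smul,
      ← du_invStereo hd, ← dv_invStereo hd]
    have h := tension_invStereo_comp hw (1, 0) (0, 1)
    have hre1 : (du (fun y => invStereo (w y)) x).re = 0 := by rw [du_invStereo hd]; simp
    have hre2 : (dv (fun y => invStereo (w y)) x).re = 0 := by rw [dv_invStereo hd]; simp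
    have h2 : (1 / 2 : ℝ) • ((du (fun y => invStereo (w y)) x * dv (fun y => invStereo (w y)) x +
        dv (fun y => invStereo (w y)) x * du (fun y => invStereo (w y)) x) * invStereo (w x)) =
        -((inner ℝ (du (fun y => invStereo (w y)) x) (dv (fun y => invStereo (w y)) x) : ℝ) •
          invStereo (w x)) := by
      rw [add_mul_swap_of_re_eq_zero hre1 hre2, Quaternion.coe_mul_eq_smul, smul_smul]
      module
    have h' : dv (du fun y => invStereo (w y)) x +
        (inner ℝ (du (fun y => invStereo (w y)) x) (dv (fun y => invStereo (w y)) x) : ℝ) •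
          invStereo (w x) = invStereoDeriv (w x) (dv (du w) x -
            2 * conj (w x) * du w x * dv w x / (1 + (‖w x‖ : ℂ) ^ 2)) := h
    rw [← h', tensionDefect, h2]
    module
  have h0 : invStereoDeriv (w x) 0 = 0 := by
    simpa using invStereoDeriv_smul (w x) 0 0
  -- Pairing with `w_u` removes the `P` term and pairing with `w_v` removes the `Q` term, so each
  -- equation contains a single logarithmic derivative.
  rw [hten, ← h0, (invStereoDeriv_injective (w x)).eq_iff, eq_zero_iff_im_conj_mul hab]
  -- The second equation is the first with `u` and `v` exchanged: its leading sign is absorbed by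
  -- the antisymmetric denominator.
  have hP' : IntegrabilityV w k x ↔ ((4 * P : ℝ) : ℂ) = 4 / (conj (dv w x) * du w x -
      dv w x * conj (du w x)) * (conj (dv w x) * dv (du w) x - dv w x * conj (dv (du w) x) +
        2 * (‖dv w x‖ : ℂ) ^ 2 * ((w x * conj (du w x) - conj (w x) * du w x) /
          (1 + (‖w x‖ : ℂ) ^ 2))) := by
    rw [IntegrabilityV, hV, ← div_neg, neg_sub, mul_comm (du w x), mul_comm _ (dv w x)]
  refine and_congr ?_ ?_
  · rw [IntegrabilityU, hU, ofReal_eq_quotient_iff hab]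
    have : (conj (du w x) * (dv (du w) x - 2 * conj (w x) * du w x * dv w x /
        (1 + (‖w x‖ : ℂ) ^ 2) + (-P) • du w x + (-Q) • dv w x)).im =
        (conj (du w x) * (dv (du w) x - 2 * conj (w x) * du w x * dv w x /
        (1 + (‖w x‖ : ℂ) ^ 2) - Q * dv w x)).im := by
      rw [add_right_comm, mul_add, Complex.add_im, neg_smul, ← sub_eq_add_neg, Complex.real_smul]
      simp; ring
    rw [this]
  · rw [hP', ofReal_eq_quotient_iff hba]
    have : (conj (dv w x) * (dv (du w) x - 2 * conj (w x) * du w x * dv w x /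
        (1 + (‖w x‖ : ℂ) ^ 2) + (-P) • du w x + (-Q) • dv w x)).im =
        (conj (dv w x) * (dv (du w) x - 2 * conj (w x) * dv w x * du w x /
        (1 + (‖w x‖ : ℂ) ^ 2) - P * du w x)).im := by
      rw [mul_add, Complex.add_im, neg_smul, ← sub_eq_add_neg, Complex.real_smul,
        mul_right_comm _ (du w x)]
      simp; ring
    rw [this]

end Integrability

end LorentzGauss
end

noncomputable section

open Set Filter

namespace LorentzGauss

/-! ### The connection form of a Gauss map and its parallel sections. -/

section Frame

/-- A field of unit imaginary quaternions and a positive function different from `1`: the left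
translated normal and the square root of minus the extrinsic curvature. -/
structure IsGaussData (n : ℝ × ℝ → ℍ[ℝ]) (s : ℝ × ℝ → ℝ) : Prop where
  re_eq_zero : ∀ y, (n y).re = 0
  unit : ∀ y, inner ℝ (n y) (n y) = (1 : ℝ)
  pos : ∀ y, 0 < s y
  ne_one : ∀ y, s y ≠ 1

/-- The coefficient of `du` in the connection form. -/
def formU (n : ℝ × ℝ → ℍ[ℝ]) (s : ℝ × ℝ → ℝ) (y : ℝ × ℝ) : ℍ[ℝ] :=
  (1 - s y)⁻¹ • (du n y * n y)

/-- The coefficient of `dv` in the connection form. -/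
def formV (n : ℝ × ℝ → ℍ[ℝ]) (s : ℝ × ℝ → ℝ) (y : ℝ × ℝ) : ℍ[ℝ] :=
  (1 + s y)⁻¹ • (dv n y * n y)

/-- The connection form, which is the left Maurer-Cartan form of the immersion. -/
def connForm (n : ℝ × ℝ → ℍ[ℝ]) (s : ℝ × ℝ → ℝ) (y : ℝ × ℝ) : ℝ × ℝ →L[ℝ] ℍ[ℝ] :=
  (ContinuousLinearMap.fst ℝ ℝ ℝ).smulRight (formU n s y) +
    (ContinuousLinearMap.snd ℝ ℝ ℝ).smulRight (formV n s y)

theorem connForm_apply (n : ℝ × ℝ → ℍ[ℝ]) (s : ℝ × ℝ → ℝ) (y X : ℝ × ℝ) :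
    connForm n s y X = X.1 • formU n s y + X.2 • formV n s y := by
  simp [connForm]

/-- `Ψ` solves the structure equation `dΨ = Ψ θ` at `y`, for the connection form `θ`. -/
def IsParallelAt (n : ℝ × ℝ → ℍ[ℝ]) (s : ℝ × ℝ → ℝ) (Ψ : ℝ × ℝ → ℍ[ℝ]) (y : ℝ × ℝ) : Prop :=
  HasFDerivAt Ψ ((ContinuousLinearMap.mul ℝ ℍ[ℝ] (Ψ y)).comp (connForm n s y)) y

theorem IsParallelAt.du_eq {n : ℝ × ℝ → ℍ[ℝ]} {s : ℝ × ℝ → ℝ} {Ψ : ℝ × ℝ → ℍ[ℝ]} {y : ℝ × ℝ}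
    (h : IsParallelAt n s Ψ y) : du Ψ y = Ψ y * formU n s y := by
  rw [du, HasFDerivAt.fderiv h]; simp [connForm_apply]

theorem IsParallelAt.dv_eq {n : ℝ × ℝ → ℍ[ℝ]} {s : ℝ × ℝ → ℝ} {Ψ : ℝ × ℝ → ℍ[ℝ]} {y : ℝ × ℝ}
    (h : IsParallelAt n s Ψ y) : dv Ψ y = Ψ y * formV n s y := by
  rw [dv, HasFDerivAt.fderiv h]; simp [connForm_apply]

theorem isParallelAt_iff {n : ℝ × ℝ → ℍ[ℝ]} {s : ℝ × ℝ → ℝ} {Ψ : ℝ × ℝ → ℍ[ℝ]} {y : ℝ × ℝ} :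
    IsParallelAt n s Ψ y ↔ DifferentiableAt ℝ Ψ y ∧ du Ψ y = Ψ y * formU n s y ∧
      dv Ψ y = Ψ y * formV n s y := by
  refine ⟨fun h => ⟨HasFDerivAt.differentiableAt h, h.du_eq, h.dv_eq⟩, fun ⟨hd, hu, hv⟩ => ?_⟩
  have e : fderiv ℝ Ψ y = (ContinuousLinearMap.mul ℝ ℍ[ℝ] (Ψ y)).comp (connForm n s y) := by
    refine ContinuousLinearMap.ext fun X => ?_
    have hX : X = X.1 • ((1, 0) : ℝ × ℝ) + X.2 • ((0, 1) : ℝ × ℝ) := by simp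
    calc fderiv ℝ Ψ y X = X.1 • du Ψ y + X.2 • dv Ψ y := by
          conv_lhs => rw [hX]
          rw [map_add, map_smul, map_smul]; rfl
      _ = _ := by rw [hu, hv]; simp [connForm_apply, mul_add]
  rw [IsParallelAt, ← e]
  exact hd.hasFDerivAt

variable {n : ℝ × ℝ → ℍ[ℝ]} {s : ℝ × ℝ → ℝ} {x : ℝ × ℝ}

theorem re_fderiv_eq_zero {f : ℝ × ℝ → ℍ[ℝ]} (hf : ∀ y, (f y).re = 0)
    (hd : DifferentiableAt ℝ f x) (X : ℝ × ℝ) : (fderiv ℝ f x X).re = 0 := by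
  have h := fderiv_inner_apply ℝ (differentiableAt_const (1 : ℍ[ℝ])) hd X
  have e : (fun y => (inner ℝ (1 : ℍ[ℝ]) (f y) : ℝ)) = fun _ => 0 := by
    funext y; simp [inner_eq_components, hf]
  rw [e] at h
  simpa [inner_eq_components] using h.symm

theorem inner_fderiv_self_eq_zero {f : ℝ × ℝ → ℍ[ℝ]} (hf : ∀ y, inner ℝ (f y) (f y) = (1 : ℝ))
    (hd : DifferentiableAt ℝ f x) (X : ℝ × ℝ) : inner ℝ (fderiv ℝ f x X) (f x) = (0 : ℝ) := by
  have h := fderiv_inner_apply ℝ hd hd X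
  have e : (fun y => (inner ℝ (f y) (f y) : ℝ)) = fun _ => 1 := funext hf
  rw [e, real_inner_comm (f x) (fderiv ℝ f x X)] at h
  simp only [fderiv_fun_const, Pi.zero_apply, zero_apply] at h
  rw [real_inner_comm]
  linarith

theorem IsGaussData.one_sub_ne (h : IsGaussData n s) (y : ℝ × ℝ) : 1 - s y ≠ 0 :=
  sub_ne_zero.2 (h.ne_one y).symm

theorem IsGaussData.one_add_ne (h : IsGaussData n s) (y : ℝ × ℝ) : 1 + s y ≠ 0 := by
  have := h.pos y; positivity

theorem IsGaussData.mul_self (h : IsGaussData n s) (y : ℝ × ℝ) : n y * n y = -1 :=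
  mul_self_of_unit (h.re_eq_zero y) (h.unit y)

theorem IsGaussData.anticomm (h : IsGaussData n s) (hd : DifferentiableAt ℝ n x) (X : ℝ × ℝ) :
    n x * fderiv ℝ n x X = -(fderiv ℝ n x X * n x) :=
  mul_eq_neg_mul_of_inner_eq_zero (h.re_eq_zero x) (re_fderiv_eq_zero h.re_eq_zero hd X)
    (by rw [real_inner_comm]; exact inner_fderiv_self_eq_zero h.unit hd X)

theorem contDiffAt_du {F : Type*} [NormedAddCommGroup F] [NormedSpace ℝ F] {f : ℝ × ℝ → F}
    (hf : ContDiffAt ℝ ∞ f x) : ContDiffAt ℝ ∞ (du f) x :=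
  (hf.fderiv_right (m := ∞) (by simp)).clm_apply contDiffAt_const

theorem contDiffAt_dv {F : Type*} [NormedAddCommGroup F] [NormedSpace ℝ F] {f : ℝ × ℝ → F}
    (hf : ContDiffAt ℝ ∞ f x) : ContDiffAt ℝ ∞ (dv f) x :=
  (hf.fderiv_right (m := ∞) (by simp)).clm_apply contDiffAt_const

theorem two_le_infty : (2 : WithTop ℕ∞) ≤ ∞ := WithTop.coe_le_coe.2 (le_top : (2 : ℕ∞) ≤ ⊤)

theorem fderiv_fderiv_apply_comm {F : Type*} [NormedAddCommGroup F] [NormedSpace ℝ F]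
    {f : ℝ × ℝ → F} (hf : ContDiffAt ℝ ∞ f x) (X Y : ℝ × ℝ) :
    fderiv ℝ (fun y => fderiv ℝ f y X) x Y = fderiv ℝ (fun y => fderiv ℝ f y Y) x X := by
  have hd : DifferentiableAt ℝ (fderiv ℝ f) x :=
    (hf.fderiv_right (m := ∞) (by simp)).differentiableAt (by simp)
  have hs : IsSymmSndFDerivAt ℝ f x := hf.isSymmSndFDerivAt (by simpa using two_le_infty)
  have e : ∀ Z W : ℝ × ℝ, fderiv ℝ (fun y => fderiv ℝ f y Z) x W = fderiv ℝ (fderiv ℝ f) x W Z := by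
    intro Z W
    rw [fderiv_clm_apply hd (differentiableAt_const Z)]
    simp
  rw [e, e, hs.eq]

theorem du_dv_comm {F : Type*} [NormedAddCommGroup F] [NormedSpace ℝ F]
    {f : ℝ × ℝ → F} (hf : ContDiffAt ℝ ∞ f x) : du (dv f) x = dv (du f) x :=
  fderiv_fderiv_apply_comm hf _ _

theorem fderiv_mul_apply {f g : ℝ × ℝ → ℍ[ℝ]} (hf : DifferentiableAt ℝ f x)
    (hg : DifferentiableAt ℝ g x) (X : ℝ × ℝ) :
    fderiv ℝ (fun y => f y * g y) x X = fderiv ℝ f x X * g x + f x * fderiv ℝ g x X := by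
  rw [show (fun y => f y * g y) = f * g from rfl, fderiv_mul' hf hg]
  simp [add_comm]

theorem fderiv_smul_apply {f : ℝ × ℝ → ℝ} {g : ℝ × ℝ → ℍ[ℝ]} (hf : DifferentiableAt ℝ f x)
    (hg : DifferentiableAt ℝ g x) (X : ℝ × ℝ) :
    fderiv ℝ (fun y => f y • g y) x X = fderiv ℝ f x X • g x + f x • fderiv ℝ g x X := by
  rw [show (fun y => f y • g y) = f • g from rfl, fderiv_smul hf hg]
  simp [add_comm]

theorem IsGaussData.contDiffAt_formU (h : IsGaussData n s) (hn : ContDiffAt ℝ ∞ n x)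
    (hs : ContDiffAt ℝ ∞ s x) : ContDiffAt ℝ ∞ (formU n s) x :=
  ((contDiffAt_const.sub hs).inv (h.one_sub_ne x)).smul ((contDiffAt_du hn).mul hn)

theorem IsGaussData.contDiffAt_formV (h : IsGaussData n s) (hn : ContDiffAt ℝ ∞ n x)
    (hs : ContDiffAt ℝ ∞ s x) : ContDiffAt ℝ ∞ (formV n s) x :=
  ((contDiffAt_const.add hs).inv (h.one_add_ne x)).smul ((contDiffAt_dv hn).mul hn)

theorem IsGaussData.contDiffAt_connForm (h : IsGaussData n s) (hn : ContDiffAt ℝ ∞ n x)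
    (hs : ContDiffAt ℝ ∞ s x) : ContDiffAt ℝ ∞ (connForm n s) x :=
  (contDiffAt_const.smulRight (h.contDiffAt_formU hn hs)).add
    (contDiffAt_const.smulRight (h.contDiffAt_formV hn hs))

/-- The curvature of the connection form is a multiple of the tension defect. -/
theorem IsGaussData.curvature_connForm (h : IsGaussData n s) (hn : ContDiffAt ℝ ∞ n x)
    (hs : ContDiffAt ℝ ∞ s x) :
    dv (formU n s) x - du (formV n s) x -
      (formU n s x * formV n s x - formV n s x * formU n s x) =
    (2 * s x / ((1 - s x) * (1 + s x))) • (tensionDefect n s x * n x) := by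
  have hdn := hn.differentiableAt (by simp)
  have hds := hs.differentiableAt (by simp)
  have e1 : dv (formU n s) x = (dv s x / (1 - s x) ^ 2) • (du n x * n x) +
      (1 - s x)⁻¹ • (dv (du n) x * n x + du n x * dv n x) := by
    have h1 : HasFDerivAt (fun y => (1 - s y)⁻¹) _ x :=
      (hasDerivAt_inv (h.one_sub_ne x)).comp_hasFDerivAt x (hds.hasFDerivAt.const_sub 1)
    have h2 := (contDiffAt_du hn).differentiableAt (by simp)
    unfold formU
    rw [dv, fderiv_smul_apply h1.differentiableAt (h2.fun_mul hdn), fderiv_mul_apply h2 hdn, h1.fderiv]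
    congr 2
    simp [dv]; ring
  have e2 : du (formV n s) x = (-du s x / (1 + s x) ^ 2) • (dv n x * n x) +
      (1 + s x)⁻¹ • (dv (du n) x * n x + dv n x * du n x) := by
    have h1 : HasFDerivAt (fun y => (1 + s y)⁻¹) _ x :=
      (hasDerivAt_inv (h.one_add_ne x)).comp_hasFDerivAt x (hds.hasFDerivAt.const_add 1)
    have h2 := (contDiffAt_dv hn).differentiableAt (by simp)
    unfold formV
    rw [du, fderiv_smul_apply h1.differentiableAt (h2.fun_mul hdn), fderiv_mul_apply h2 hdn, h1.fderiv,
      ← du_dv_comm hn]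
    congr 2
    simp [du]; ring
  rw [e1, e2]
  exact curvature_eq (h.mul_self x) (h.anticomm hdn _) (h.anticomm hdn _) (h.pos x).ne'
    (h.one_sub_ne x) (h.one_add_ne x)

/-- A smooth solution of the structure equation forces the tension defect to vanish. -/
theorem IsGaussData.tensionDefect_eq_zero (h : IsGaussData n s) (hn : ContDiffAt ℝ ∞ n x)
    (hs : ContDiffAt ℝ ∞ s x) {Ψ : ℝ × ℝ → ℍ[ℝ]} (hΨ : ContDiffAt ℝ ∞ Ψ x) (hΨ0 : Ψ x ≠ 0)
    (hpar : ∀ᶠ y in 𝓝 x, IsParallelAt n s Ψ y) : tensionDefect n s x = 0 := by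
  have hd := hΨ.differentiableAt (by simp)
  have hU := (h.contDiffAt_formU hn hs).differentiableAt (by simp)
  have hV := (h.contDiffAt_formV hn hs).differentiableAt (by simp)
  have e1 : dv (du Ψ) x = Ψ x * formV n s x * formU n s x + Ψ x * dv (formU n s) x := by
    have : du Ψ =ᶠ[𝓝 x] fun y => Ψ y * formU n s y := hpar.mono fun y hy => hy.du_eq
    rw [dv, this.fderiv_eq, fderiv_mul_apply hd hU, ← hpar.self_of_nhds.dv_eq]; rfl
  have e2 : du (dv Ψ) x = Ψ x * formU n s x * formV n s x + Ψ x * du (formV n s) x := by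
    have : dv Ψ =ᶠ[𝓝 x] fun y => Ψ y * formV n s y := hpar.mono fun y hy => hy.dv_eq
    rw [du, this.fderiv_eq, fderiv_mul_apply hd hV, ← hpar.self_of_nhds.du_eq]; rfl
  have e3 := du_dv_comm hΨ
  rw [e1, e2] at e3
  -- Equality of the mixed derivatives of `Ψ` says that `Ψ` times the curvature vanishes.
  have e4 : Ψ x * (dv (formU n s) x - du (formV n s) x -
      (formU n s x * formV n s x - formV n s x * formU n s x)) = 0 := by
    rw [← sub_eq_zero.2 e3.symm]; noncomm_ring
  rw [h.curvature_connForm hn hs] at e4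
  have hn0 : n x ≠ 0 := by
    intro h0; have := h.unit x; simp [h0] at this
  have hc : 2 * s x / ((1 - s x) * (1 + s x)) ≠ 0 :=
    div_ne_zero (mul_ne_zero two_ne_zero (h.pos x).ne')
      (mul_ne_zero (h.one_sub_ne x) (h.one_add_ne x))
  simpa [hΨ0, hc, hn0] using e4

theorem IsGaussData.re_formU (h : IsGaussData n s) (hn : DifferentiableAt ℝ n x) :
    (formU n s x).re = 0 := by
  have h1 := re_mul_of_re_eq_zero (b := n x) (re_fderiv_eq_zero h.re_eq_zero hn (1, 0))
  rw [inner_fderiv_self_eq_zero h.unit hn, neg_zero] at h1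
  rw [formU, Quaternion.re_smul, du, h1, smul_zero]

theorem IsGaussData.re_formV (h : IsGaussData n s) (hn : DifferentiableAt ℝ n x) :
    (formV n s x).re = 0 := by
  have h1 := re_mul_of_re_eq_zero (b := n x) (re_fderiv_eq_zero h.re_eq_zero hn (0, 1))
  rw [inner_fderiv_self_eq_zero h.unit hn, neg_zero] at h1
  rw [formV, Quaternion.re_smul, dv, h1, smul_zero]

theorem IsGaussData.re_connForm (h : IsGaussData n s) (hn : DifferentiableAt ℝ n x) (X : ℝ × ℝ) :
    (connForm n s x X).re = 0 := by
  simp [connForm_apply, h.re_formU hn, h.re_formV hn]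

theorem eventually_contDiffAt {F : Type*} [NormedAddCommGroup F] [NormedSpace ℝ F]
    {f : ℝ × ℝ → F} {U : Set (ℝ × ℝ)} (hU : IsOpen U) (hf : ContDiffOn ℝ ∞ f U) (hx : x ∈ U) :
    ContDiffAt ℝ ∞ f x := hf.contDiffAt (hU.mem_nhds hx)

/-- Local solvability of the structure equation when the tension defect vanishes. -/
theorem IsGaussData.exists_isParallelAt (h : IsGaussData n s)
    (hn : ∀ᶠ y in 𝓝 x, ContDiffAt ℝ ∞ n y) (hs : ∀ᶠ y in 𝓝 x, ContDiffAt ℝ ∞ s y)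
    (hT : ∀ᶠ y in 𝓝 x, tensionDefect n s y = 0) :
    ∃ φ : ℝ × ℝ → ℍ[ℝ], ∀ᶠ y in 𝓝 x, IsParallelAt n s φ y ∧ ‖φ y‖ = 1 := by
  have hω := h.contDiffAt_connForm hn.self_of_nhds hs.self_of_nhds
  obtain ⟨φ, h0, hφ⟩ := exists_parallel_section (hω.of_le two_le_infty) (by
    filter_upwards [hn, hs, hT] with y hny hsy hTy X Y
    have hU := (h.contDiffAt_formU hny hsy).differentiableAt (by simp)
    have hV := (h.contDiffAt_formV hny hsy).differentiableAt (by simp)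
    have hωy := (h.contDiffAt_connForm hny hsy).differentiableAt (by simp)
    have hcurv := h.curvature_connForm hny hsy
    rw [hTy, zero_mul, smul_zero, sub_eq_zero, sub_eq_iff_eq_add] at hcurv
    -- Flatness is bilinear and alternating in the two vectors, so after expansion in `∂_u`, `∂_v`
    -- only the relation `hcurv` is needed.
    have e : ∀ Z W : ℝ × ℝ, fderiv ℝ (connForm n s) y W Z =
        Z.1 • (W.1 • du (formU n s) y + W.2 • dv (formU n s) y) +
          Z.2 • (W.1 • du (formV n s) y + W.2 • dv (formV n s) y) := by
      intro Z W
      have e1 : fderiv ℝ (connForm n s) y W Z =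
          fderiv ℝ (fun p => Z.1 • formU n s p + Z.2 • formV n s p) y W := by
        have : (fun p => Z.1 • formU n s p + Z.2 • formV n s p) = fun p => connForm n s p Z :=
          funext fun p => (connForm_apply n s p Z).symm
        rw [this, fderiv_clm_apply hωy (differentiableAt_const Z)]
        simp
      have hW : W = W.1 • ((1, 0) : ℝ × ℝ) + W.2 • ((0, 1) : ℝ × ℝ) := by simp
      have e2 : ∀ f : ℝ × ℝ → ℍ[ℝ], fderiv ℝ f y W = W.1 • du f y + W.2 • dv f y := by
        intro f
        conv_lhs => rw [hW]
        rw [map_add, map_smul, map_smul]; rfl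
      have e3 : HasFDerivAt (fun p => Z.1 • formU n s p + Z.2 • formV n s p) _ y :=
        (hU.hasFDerivAt.const_smul Z.1).add (hV.hasFDerivAt.const_smul Z.2)
      rw [e1, e3.fderiv, add_apply, smul_apply, smul_apply, e2, e2]
    rw [e, e, connForm_apply, connForm_apply, hcurv]
    simp only [add_mul, mul_add, smul_mul_assoc, mul_smul_comm, smul_add, smul_sub, smul_smul]
    module)
  refine ⟨φ, ?_⟩
  have hd : ∀ᶠ y in 𝓝 x, DifferentiableAt ℝ n y := hn.mono fun y hy => hy.differentiableAt (by simp)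
  obtain ⟨r, hr0, hr⟩ := Metric.eventually_nhds_iff_ball.1 (hφ.and hd)
  -- The form is imaginary-valued, so `⟨φ, φ θ⟩ = |φ|² Re θ = 0` and the norm of `φ` stays equal to
  -- its value `1` at `x`.
  have hfd : ∀ y ∈ Metric.ball x r,
      HasFDerivAt (fun y => (inner ℝ (φ y) (φ y) : ℝ)) (0 : ℝ × ℝ →L[ℝ] ℝ) y := by
    intro y hy
    obtain ⟨h1, h2⟩ := hr y hy
    refine (h1.inner ℝ h1).congr_fderiv (ContinuousLinearMap.ext fun X => ?_)
    have hre := h.re_connForm h2 X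
    simp only [zero_apply, ContinuousLinearMap.comp_apply, ContinuousLinearMap.prod_apply,
      fderivInnerCLM_apply, ContinuousLinearMap.mul_apply']
    simp only [inner_eq_components, Quaternion.re_mul, Quaternion.imI_mul, Quaternion.imJ_mul,
      Quaternion.imK_mul, hre]
    ring
  filter_upwards [hφ, Metric.ball_mem_nhds x hr0] with y hy hyr
  refine ⟨hy, ?_⟩
  have hc := (convex_ball x r).is_const_of_fderivWithin_eq_zero (𝕜 := ℝ)
    (f := fun y => (inner ℝ (φ y) (φ y) : ℝ))
    (fun z hz => (hfd z hz).differentiableAt.differentiableWithinAt)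
    (fun z hz => by
      rw [fderivWithin_of_isOpen Metric.isOpen_ball hz, (hfd z hz).fderiv])
    hyr (Metric.mem_ball_self hr0)
  rw [norm_eq_one_iff_inner]
  simpa [h0] using hc

/-- Solutions of the structure equation on an open set are smooth. -/
theorem contDiffOn_of_isParallelAt {U : Set (ℝ × ℝ)} (hU : IsOpen U) {Ψ : ℝ × ℝ → ℍ[ℝ]}
    (hω : ContDiffOn ℝ ∞ (connForm n s) U) (hΨ : ∀ y ∈ U, IsParallelAt n s Ψ y) :
    ContDiffOn ℝ ∞ Ψ U := by
  have hd : DifferentiableOn ℝ Ψ U :=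
    fun y hy => (HasFDerivAt.differentiableAt (hΨ y hy)).differentiableWithinAt
  rw [contDiffOn_infty]
  intro k
  -- Bootstrapping: if `Ψ` is `C^k`, then so is `dΨ = Ψ θ`.
  induction k with
  | zero => exact contDiffOn_zero.2 hd.continuousOn
  | succ k ih =>
    push_cast
    rw [contDiffOn_succ_iff_fderiv_of_isOpen hU]
    refine ⟨hd, by simp, ?_⟩
    have h1 : ContDiffOn ℝ k
        (fun y => (ContinuousLinearMap.mul ℝ ℍ[ℝ] (Ψ y)).comp (connForm n s y)) U :=
      ((ContinuousLinearMap.mul ℝ ℍ[ℝ]).contDiff.comp_contDiffOn ih).clm_comp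
        (hω.of_le (by exact_mod_cast le_top))
    exact h1.congr fun y hy => HasFDerivAt.fderiv (hΨ y hy)

end Frame

end LorentzGauss
end

noncomputable section

open Set Filter

namespace LorentzGauss

/-! ### Geometry of the structure equation in one null chart. -/

section Charts

variable {n : ℝ × ℝ → ℍ[ℝ]} {s : ℝ × ℝ → ℝ} {x : ℝ × ℝ} {Ψ N : ℝ × ℝ → ℍ[ℝ]}

theorem star_mul_cancel {q : ℍ[ℝ]} (hq : ‖q‖ = 1) (a : ℍ[ℝ]) : q * (star q * a) = a := by
  have : q * star q = 1 := by
    rw [Quaternion.self_mul_star, Quaternion.normSq_eq_norm_mul_self, hq]; simp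
  rw [← mul_assoc, this, one_mul]

theorem re_star_mul (a b : ℍ[ℝ]) : (star a * b).re = inner ℝ a b := by
  rw [inner_eq_components]; simp

/-- Quaternion conjugation as a continuous linear map. -/
def starCLM : ℍ[ℝ] →L[ℝ] ℍ[ℝ] :=
  LinearMap.mkContinuous
    { toFun := star
      map_add' := star_add
      map_smul' := fun r a => by ext <;> simp } 1 fun a => by simp

theorem contDiffAt_star {f : ℝ × ℝ → ℍ[ℝ]} (hf : ContDiffAt ℝ ∞ f x) :
    ContDiffAt ℝ ∞ (fun y => star (f y)) x :=
  starCLM.contDiff.contDiffAt.comp x hf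

theorem fderiv_star {f : ℝ × ℝ → ℍ[ℝ]} (hf : DifferentiableAt ℝ f x) (X : ℝ × ℝ) :
    fderiv ℝ (fun y => star (f y)) x X = star (fderiv ℝ f x X) := by
  have h : HasFDerivAt (fun y => star (f y)) _ x :=
    starCLM.hasFDerivAt.comp x hf.hasFDerivAt
  rw [h.fderiv]; rfl

/-- Two solutions of the structure equation differ by a constant left factor. -/
theorem eventually_mul_star_eq (h : IsGaussData n s) {Ψ₁ Ψ₂ : ℝ × ℝ → ℍ[ℝ]}
    (hn : ∀ᶠ y in 𝓝 x, DifferentiableAt ℝ n y) (h₁ : ∀ᶠ y in 𝓝 x, IsParallelAt n s Ψ₁ y)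
    (h₂ : ∀ᶠ y in 𝓝 x, IsParallelAt n s Ψ₂ y) :
    ∀ᶠ y in 𝓝 x, Ψ₂ y * star (Ψ₁ y) = Ψ₂ x * star (Ψ₁ x) := by
  obtain ⟨r, hr0, hr⟩ := Metric.eventually_nhds_iff_ball.1 (hn.and (h₁.and h₂))
  have hd : ∀ y ∈ Metric.ball x r, DifferentiableAt ℝ (fun y => Ψ₂ y * star (Ψ₁ y)) y ∧
      fderiv ℝ (fun y => Ψ₂ y * star (Ψ₁ y)) y = 0 := by
    intro y hy
    obtain ⟨hny, h1, h2⟩ := hr y hy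
    have d1 := HasFDerivAt.differentiableAt h1
    have d2 := HasFDerivAt.differentiableAt h2
    have d3 : DifferentiableAt ℝ (fun y => star (Ψ₁ y)) y :=
      starCLM.differentiableAt.comp y d1
    refine ⟨d2.mul d3, ContinuousLinearMap.ext fun X => ?_⟩
    rw [fderiv_mul_apply d2 d3, fderiv_star d1, HasFDerivAt.fderiv h1, HasFDerivAt.fderiv h2]
    simp only [ContinuousLinearMap.comp_apply, ContinuousLinearMap.mul_apply', zero_apply, star_mul]
    -- The derivative is `Ψ₂ (θ + θ*) Ψ₁*`, which vanishes since `θ` is imaginary.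
    rw [Quaternion.star_eq_neg.2 (h.re_connForm hny X)]
    noncomm_ring
  filter_upwards [Metric.ball_mem_nhds x hr0] with y hy
  exact (convex_ball x r).is_const_of_fderivWithin_eq_zero (𝕜 := ℝ)
    (f := fun y => Ψ₂ y * star (Ψ₁ y))
    (fun z hz => (hd z hz).1.differentiableWithinAt)
    (fun z hz => by rw [fderivWithin_of_isOpen Metric.isOpen_ball hz, (hd z hz).2])
    hy (Metric.mem_ball_self hr0)

theorem IsParallelAt.const_mul (h : IsParallelAt n s Ψ x) (c : ℍ[ℝ]) :
    IsParallelAt n s (fun y => c * Ψ y) x := by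
  refine (HasFDerivAt.const_mul h c).congr_fderiv (ContinuousLinearMap.ext fun X => ?_)
  simp [mul_assoc]

theorem IsParallelAt.congr (h : IsParallelAt n s Ψ x) {n' : ℝ × ℝ → ℍ[ℝ]} {s' : ℝ × ℝ → ℝ}
    {Ψ' : ℝ × ℝ → ℍ[ℝ]} (hn : n' =ᶠ[𝓝 x] n) (hs : s' =ᶠ[𝓝 x] s) (hΨ : Ψ' =ᶠ[𝓝 x] Ψ) :
    IsParallelAt n' s' Ψ' x := by
  have e : connForm n' s' x = connForm n s x := by
    simp only [connForm, formU, formV, du, dv, hn.fderiv_eq, hn.eq_of_nhds, hs.eq_of_nhds]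
  rw [IsParallelAt, e, hΨ.eq_of_nhds]
  exact HasFDerivAt.congr_of_eventuallyEq h hΨ

/-- Invariance of the structure equation under changes of null coordinates. -/
theorem IsParallelAt.comp_null {τ : ℝ × ℝ → ℝ × ℝ} (h : IsParallelAt n s Ψ (τ x))
    (hn : DifferentiableAt ℝ n (τ x)) (hτ : DifferentiableAt ℝ τ x) (hu : (du τ x).2 = 0)
    (hv : (dv τ x).1 = 0) :
    IsParallelAt (fun y => n (τ y)) (fun y => s (τ y)) (fun y => Ψ (τ y)) x := by
  have hd := HasFDerivAt.differentiableAt h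
  -- A null transition only rescales `∂_u` and `∂_v`, and both sides of each half of the structure
  -- equation scale by the same factor.
  have eu : du τ x = (du τ x).1 • ((1, 0) : ℝ × ℝ) := by ext <;> simp [hu]
  have ev : dv τ x = (dv τ x).2 • ((0, 1) : ℝ × ℝ) := by ext <;> simp [hv]
  have cu : ∀ f : ℝ × ℝ → ℍ[ℝ], DifferentiableAt ℝ f (τ x) →
      du (fun y => f (τ y)) x = (du τ x).1 • du f (τ x) := by
    intro f hf
    have : HasFDerivAt (fun y => f (τ y)) _ x := hf.hasFDerivAt.comp x hτ.hasFDerivAt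
    rw [du, this.fderiv, ContinuousLinearMap.comp_apply]
    change fderiv ℝ f (τ x) (du τ x) = _
    rw [eu, map_smul]; simp [du]
  have cv : ∀ f : ℝ × ℝ → ℍ[ℝ], DifferentiableAt ℝ f (τ x) →
      dv (fun y => f (τ y)) x = (dv τ x).2 • dv f (τ x) := by
    intro f hf
    have : HasFDerivAt (fun y => f (τ y)) _ x := hf.hasFDerivAt.comp x hτ.hasFDerivAt
    rw [dv, this.fderiv, ContinuousLinearMap.comp_apply]
    change fderiv ℝ f (τ x) (dv τ x) = _
    rw [ev, map_smul]; simp [dv]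
  refine isParallelAt_iff.2 ⟨hd.comp x hτ, ?_, ?_⟩
  · rw [cu Ψ hd, h.du_eq, formU, formU, cu n hn]
    simp only [smul_mul_assoc, mul_smul_comm]
    rw [smul_comm]
  · rw [cv Ψ hd, h.dv_eq, formV, formV, cv n hn]
    simp only [smul_mul_assoc, mul_smul_comm]
    rw [smul_comm]

/-- With `D = det (a, b, c)`, one has `det I = D²`, and `det II = -f² = -(t D)²` in asymptotic
coordinates. -/
theorem extrinsicCurvature_eq {a b c : ℍ[ℝ]} {f t : ℝ} (hΨ : ‖Ψ x‖ = 1) (ha : a.re = 0)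
    (hb : b.re = 0) (hc : c.re = 0) (h1 : inner ℝ c c = (1 : ℝ)) (hac : inner ℝ a c = (0 : ℝ))
    (hbc : inner ℝ b c = (0 : ℝ)) (hu : du Ψ x = Ψ x * a) (hv : dv Ψ x = Ψ x * b)
    (h11 : secondForm Ψ N x (1, 0) (1, 0) = 0) (h12 : secondForm Ψ N x (1, 0) (0, 1) = f)
    (h21 : secondForm Ψ N x (0, 1) (1, 0) = f) (hD : imDet a b c ≠ 0)
    (hf : f = t * imDet a b c) : extrinsicCurvature Ψ N x = -t ^ 2 := by
  have hI : formDet (firstForm Ψ x) = imDet a b c ^ 2 := by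
    have e : ∀ X Y : ℝ × ℝ, firstForm Ψ x X Y = inner ℝ (fderiv ℝ Ψ x X) (fderiv ℝ Ψ x Y) :=
      fun _ _ => rfl
    rw [imDet_sq ha hb hc h1 hac hbc, formDet, e, e, e, e]
    change inner ℝ (du Ψ x) (du Ψ x) * inner ℝ (dv Ψ x) (dv Ψ x) -
      inner ℝ (du Ψ x) (dv Ψ x) * inner ℝ (dv Ψ x) (du Ψ x) = _
    rw [hu, hv]
    simp only [inner_mul_mul_of_norm_one hΨ]
  rw [extrinsicCurvature, hI, formDet, h11, h12, h21, hf]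
  field_simp
  ring

/-- The geometry of a solution of the structure equation. -/
theorem IsParallelAt.geometry (hp : IsParallelAt n s Ψ x) (h : IsGaussData n s)
    (hn : DifferentiableAt ℝ n x) (hΨ : ‖Ψ x‖ = 1)
    (hdet : 0 < (1 - s x ^ 2) * imDet (du n x) (dv n x) (n x)) :
    Function.Injective (fderiv ℝ Ψ x) ∧
    (∀ X, inner ℝ (Ψ x * n x) (fderiv ℝ Ψ x X) = (0 : ℝ)) ∧
    secondForm Ψ (fun y => Ψ y * n y) x (1, 0) (1, 0) = 0 ∧
    secondForm Ψ (fun y => Ψ y * n y) x (0, 1) (0, 1) = 0 ∧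
    0 < secondForm Ψ (fun y => Ψ y * n y) x (1, 0) (0, 1) ∧
    0 < imDet (star (Ψ x) * du Ψ x) (star (Ψ x) * dv Ψ x) (n x) ∧
    extrinsicCurvature Ψ (fun y => Ψ y * n y) x = -s x ^ 2 := by
  have hd := HasFDerivAt.differentiableAt hp
  have hA := h.re_formU hn
  have hB := h.re_formV hn
  have hnre := h.re_eq_zero x
  have h1 := h.unit x
  have hnn := h.mul_self x
  have hnu : (du n x).re = 0 := re_fderiv_eq_zero h.re_eq_zero hn _
  have hnv : (dv n x).re = 0 := re_fderiv_eq_zero h.re_eq_zero hn _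
  have hAn : inner ℝ (formU n s x) (n x) = (0 : ℝ) := by
    rw [formU, inner_smul_left, inner_mul_right_eq_zero hnu, mul_zero]
  have hBn : inner ℝ (formV n s x) (n x) = (0 : ℝ) := by
    rw [formV, inner_smul_left, inner_mul_right_eq_zero hnv, mul_zero]
  have hα := h.one_sub_ne x
  have hβ := h.one_add_ne x
  have hD : 0 < imDet (formU n s x) (formV n s x) (n x) := by
    rw [formU, formV, imDet_smul_smul, imDet_mul_right hnu hnv hnre h1
      (inner_fderiv_self_eq_zero h.unit hn _) (inner_fderiv_self_eq_zero h.unit hn _)]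
    -- Multiplying and dividing by `(1 - s²)` exhibits the sign hypothesis over a square.
    have : (1 - s x)⁻¹ * (1 + s x)⁻¹ * imDet (du n x) (dv n x) (n x) =
        ((1 - s x ^ 2) * imDet (du n x) (dv n x) (n x)) / ((1 - s x) * (1 + s x)) ^ 2 := by
      field_simp
      ring
    rw [this]
    positivity
  -- The left side is `Ψ⁻¹ N_u`: a quarter turn of `Ψ⁻¹ Ψ_u` scaled by `s`, hence orthogonal to it.
  -- The `v` direction has the factor `-s`.
  have hAN : formU n s x * n x + du n x = s x • (formU n s x * n x) := by
    have : formU n s x * n x = -((1 - s x)⁻¹ • du n x) := by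
      rw [formU, smul_mul_assoc, mul_assoc, hnn]; simp
    rw [this]
    match_scalars
    field_simp; ring
  have hBN : formV n s x * n x + dv n x = (-s x) • (formV n s x * n x) := by
    have : formV n s x * n x = -((1 + s x)⁻¹ • dv n x) := by
      rw [formV, smul_mul_assoc, mul_assoc, hnn]; simp
    rw [this]
    match_scalars
    field_simp; ring
  have hNu : fderiv ℝ (fun y => Ψ y * n y) x (1, 0) = Ψ x * (s x • (formU n s x * n x)) := by
    rw [fderiv_mul_apply hd hn, ← hAN, mul_add, ← mul_assoc, ← hp.du_eq]; rfl
  have hNv : fderiv ℝ (fun y => Ψ y * n y) x (0, 1) = Ψ x * ((-s x) • (formV n s x * n x)) := by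
    rw [fderiv_mul_apply hd hn, ← hBN, mul_add, ← mul_assoc, ← hp.dv_eq]; rfl
  have hBA : imDet (formV n s x) (formU n s x) (n x) = -imDet (formU n s x) (formV n s x) (n x) := by
    simp [imDet, Matrix.det_fin_three]; ring
  have h11 : secondForm Ψ (fun y => Ψ y * n y) x (1, 0) (1, 0) = 0 := by
    rw [secondForm, hNu, show fderiv ℝ Ψ x (1, 0) = _ from hp.du_eq, inner_neg_left,
      inner_mul_mul_of_norm_one hΨ, inner_smul_left, inner_mul_right_self hnre]
    simp
  have h22 : secondForm Ψ (fun y => Ψ y * n y) x (0, 1) (0, 1) = 0 := by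
    rw [secondForm, hNv, show fderiv ℝ Ψ x (0, 1) = _ from hp.dv_eq, inner_neg_left,
      inner_mul_mul_of_norm_one hΨ, inner_smul_left, inner_mul_right_self hnre]
    simp
  have h12 : secondForm Ψ (fun y => Ψ y * n y) x (1, 0) (0, 1) =
      s x * imDet (formU n s x) (formV n s x) (n x) := by
    rw [secondForm, hNu, show fderiv ℝ Ψ x (0, 1) = _ from hp.dv_eq, inner_neg_left,
      inner_mul_mul_of_norm_one hΨ, inner_smul_left, inner_mul_eq_imDet hA hB hnre]
    simp
  have h21 : secondForm Ψ (fun y => Ψ y * n y) x (0, 1) (1, 0) =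
      s x * imDet (formU n s x) (formV n s x) (n x) := by
    rw [secondForm, hNv, show fderiv ℝ Ψ x (1, 0) = _ from hp.du_eq, inner_neg_left,
      inner_mul_mul_of_norm_one hΨ, inner_smul_left, inner_mul_eq_imDet hB hA hnre, hBA]
    simp
  have hval : ∀ X, fderiv ℝ Ψ x X = Ψ x * (X.1 • formU n s x + X.2 • formV n s x) := by
    intro X
    rw [HasFDerivAt.fderiv hp, ← connForm_apply]; simp
  refine ⟨?_, ?_, h11, h22, ?_, ?_, ?_⟩
  · rw [injective_iff_map_eq_zero]
    intro X hX
    rw [hval] at hX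
    have hΨ0 : Ψ x ≠ 0 := by intro h0; simp [h0] at hΨ
    have hX' := (mul_eq_zero.1 hX).resolve_left hΨ0
    -- Cramer's rule: the coefficients of a vanishing combination of the frame are zero.
    have e1 : X.1 * imDet (formU n s x) (formV n s x) (n x) =
        imDet (X.1 • formU n s x + X.2 • formV n s x) (formV n s x) (n x) := by
      simp [imDet, Matrix.det_fin_three]; ring
    have e2 : X.2 * imDet (formU n s x) (formV n s x) (n x) =
        imDet (formU n s x) (X.1 • formU n s x + X.2 • formV n s x) (n x) := by
      simp [imDet, Matrix.det_fin_three]; ring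
    rw [hX'] at e1 e2
    have z1 : imDet 0 (formV n s x) (n x) = 0 := by simp [imDet, Matrix.det_fin_three]
    have z2 : imDet (formU n s x) 0 (n x) = 0 := by simp [imDet, Matrix.det_fin_three]
    rw [z1] at e1
    rw [z2] at e2
    exact Prod.ext ((mul_eq_zero.1 e1).resolve_right hD.ne')
      ((mul_eq_zero.1 e2).resolve_right hD.ne')
  · intro X
    rw [hval, inner_mul_mul_of_norm_one hΨ, inner_add_right, inner_smul_right, inner_smul_right,
      real_inner_comm, hAn, real_inner_comm, hBn]
    simp
  · rw [h12]
    exact mul_pos (h.pos x) hD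
  · rw [hp.du_eq, hp.dv_eq, ← mul_assoc, ← mul_assoc, star_mul_self_of_norm_one hΨ, one_mul,
      one_mul]
    exact hD
  · exact extrinsicCurvature_eq hΨ hA hB hnre h1 hAn hBn hp.du_eq hp.dv_eq h11 h12 h21 hD.ne' rfl

/-- Differentiate `⟨N, Ψ_Y⟩ = 0`. The symmetry of the second fundamental form then follows from that
of second derivatives. -/
theorem secondForm_eq {U : Set (ℝ × ℝ)} (hU : IsOpen U) (hx : x ∈ U)
    (hΨ : ContDiffOn ℝ ∞ Ψ U) (hN : ContDiffOn ℝ ∞ N U)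
    (horth : ∀ y ∈ U, ∀ X : ℝ × ℝ, inner ℝ (N y) (fderiv ℝ Ψ y X) = (0 : ℝ)) (X Y : ℝ × ℝ) :
    secondForm Ψ N x X Y = inner ℝ (N x) (fderiv ℝ (fun y => fderiv ℝ Ψ y Y) x X) := by
  have hΨx := eventually_contDiffAt hU hΨ hx
  have hNx := eventually_contDiffAt hU hN hx
  have hd : DifferentiableAt ℝ (fun y => fderiv ℝ Ψ y Y) x :=
    ((hΨx.fderiv_right (m := ∞) (by simp)).clm_apply contDiffAt_const).differentiableAt (by simp)
  have h := fderiv_inner_apply ℝ (hNx.differentiableAt (by simp)) hd X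
  have e : (fun y => (inner ℝ (N y) (fderiv ℝ Ψ y Y) : ℝ)) =ᶠ[𝓝 x] fun _ => 0 := by
    filter_upwards [hU.mem_nhds hx] with y hy
    exact horth y hy Y
  rw [e.fderiv_eq] at h
  simp only [fderiv_fun_const, Pi.zero_apply, zero_apply] at h
  rw [secondForm, inner_neg_left]
  linarith

/-- Second order data of an immersion in asymptotic coordinates: the structure equation. -/
theorem exists_structure_equation {U : Set (ℝ × ℝ)} (hU : IsOpen U) (hx : x ∈ U)
    (hΨ : ContDiffOn ℝ ∞ Ψ U) (hN : ContDiffOn ℝ ∞ N U)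
    (hΨ1 : ∀ y, ‖Ψ y‖ = 1) (hN1 : ∀ y, ‖N y‖ = 1) (hΨN : ∀ y, inner ℝ (Ψ y) (N y) = (0 : ℝ))
    (horth : ∀ y ∈ U, ∀ X : ℝ × ℝ, inner ℝ (N y) (fderiv ℝ Ψ y X) = (0 : ℝ))
    (hn : ∀ y, n y = star (Ψ y) * N y)
    (h11 : secondForm Ψ N x (1, 0) (1, 0) = 0) (h22 : secondForm Ψ N x (0, 1) (0, 1) = 0)
    (h12 : 0 < secondForm Ψ N x (1, 0) (0, 1))
    (hD : 0 < imDet (star (Ψ x) * du Ψ x) (star (Ψ x) * dv Ψ x) (n x)) :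
    ∃ t : ℝ, 0 < t ∧ extrinsicCurvature Ψ N x = -t ^ 2 ∧
      du n x * n x = (1 - t) • (star (Ψ x) * du Ψ x) ∧
      dv n x * n x = (1 + t) • (star (Ψ x) * dv Ψ x) := by
  have hΨx := eventually_contDiffAt hU hΨ hx
  have hNx := eventually_contDiffAt hU hN hx
  have hd := hΨx.differentiableAt (by simp)
  have hnx : ContDiffAt ℝ ∞ n x := by
    rw [show n = fun y => star (Ψ y) * N y from funext hn]
    exact (contDiffAt_star hΨx).mul hNx
  have hnd := hnx.differentiableAt (by simp)
  have hNn : ∀ y, N y = Ψ y * n y := fun y => by rw [hn, star_mul_cancel (hΨ1 y)]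
  have hstar : ∀ y, ‖star (Ψ y)‖ = 1 := fun y => by rw [Quaternion.norm_star, hΨ1]
  have hre : ∀ y, (n y).re = 0 := by
    intro y
    rw [hn]
    exact (re_star_mul _ _).trans (hΨN y)
  have hunit : ∀ y, inner ℝ (n y) (n y) = (1 : ℝ) := by
    intro y
    rw [hn, inner_mul_mul_of_norm_one (hstar y), ← norm_eq_one_iff_inner, hN1]
  have ha : ∀ X, (star (Ψ x) * fderiv ℝ Ψ x X).re = 0 := by
    intro X
    rw [re_star_mul, real_inner_comm]
    exact inner_fderiv_self_eq_zero (fun y => norm_eq_one_iff_inner.1 (hΨ1 y)) hd X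
  have han : ∀ X, inner ℝ (star (Ψ x) * fderiv ℝ Ψ x X) (n x) = (0 : ℝ) := by
    intro X
    rw [hn, inner_mul_mul_of_norm_one (hstar x), real_inner_comm, horth x hx]
  have hback : ∀ X, Ψ x * (star (Ψ x) * fderiv ℝ Ψ x X) = fderiv ℝ Ψ x X :=
    fun X => star_mul_cancel (hΨ1 x) _
  have hdN : ∀ X, fderiv ℝ N x X =
      Ψ x * (star (Ψ x) * fderiv ℝ Ψ x X * n x + fderiv ℝ n x X) := by
    intro X
    rw [show N = fun y => Ψ y * n y from funext hNn, fderiv_mul_apply hd hnd, mul_add,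
      ← mul_assoc, hback]
  have hII : ∀ X Y, secondForm Ψ N x X Y = -inner ℝ (star (Ψ x) * fderiv ℝ Ψ x X * n x +
      fderiv ℝ n x X) (star (Ψ x) * fderiv ℝ Ψ x Y) := by
    intro X Y
    rw [secondForm, hdN, ← hback Y, inner_neg_left, inner_mul_mul_of_norm_one (hΨ1 x), hback]
  have hsymm : secondForm Ψ N x (0, 1) (1, 0) = secondForm Ψ N x (1, 0) (0, 1) := by
    rw [secondForm_eq hU hx hΨ hN horth, secondForm_eq hU hx hΨ hN horth,
      fderiv_fderiv_apply_comm hΨx]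
  have hxa : inner ℝ (du n x) (star (Ψ x) * du Ψ x) = (0 : ℝ) := by
    have := hII (1, 0) (1, 0)
    rw [h11, inner_add_left, inner_mul_right_self (hre x), zero_add] at this
    exact neg_eq_zero.1 this.symm
  have hyb : inner ℝ (dv n x) (star (Ψ x) * dv Ψ x) = (0 : ℝ) := by
    have := hII (0, 1) (0, 1)
    rw [h22, inner_add_left, inner_mul_right_self (hre x), zero_add] at this
    exact neg_eq_zero.1 this.symm
  obtain ⟨t, ht0, ht, hu, hv⟩ := exists_asymptotic_weingarten (ha _) (ha _) (hre x)
    (re_fderiv_eq_zero hre hnd _) (re_fderiv_eq_zero hre hnd _) (hunit x) (han _) (han _)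
    (inner_fderiv_self_eq_zero hunit hnd _) (inner_fderiv_self_eq_zero hunit hnd _) hxa hyb hD h12
    (by rw [hII, neg_neg]) (by rw [← hsymm, hII, neg_neg])
  exact ⟨t, ht0, extrinsicCurvature_eq (hΨ1 x) (ha _) (ha _) (hre x) (hunit x) (han _) (han _)
    (hback _).symm (hback _).symm h11 rfl hsymm hD.ne' ht, hu, hv⟩

/-- The structure equation and the orientation of the Gauss map of an immersion. -/
theorem isParallelAt_of_structure_equation (h : IsGaussData n s) (hn : DifferentiableAt ℝ n x)
    (hΨ : DifferentiableAt ℝ Ψ x) (hΨ1 : ‖Ψ x‖ = 1)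
    (hu : du n x * n x = (1 - s x) • (star (Ψ x) * du Ψ x))
    (hv : dv n x * n x = (1 + s x) • (star (Ψ x) * dv Ψ x))
    (hD : 0 < imDet (star (Ψ x) * du Ψ x) (star (Ψ x) * dv Ψ x) (n x)) :
    IsParallelAt n s Ψ x ∧ 0 < (1 - s x ^ 2) * imDet (du n x) (dv n x) (n x) := by
  have hα := h.one_sub_ne x
  have hβ := h.one_add_ne x
  refine ⟨isParallelAt_iff.2 ⟨hΨ, ?_, ?_⟩, ?_⟩
  · rw [formU, hu, inv_smul_smul₀ hα, star_mul_cancel hΨ1]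
  · rw [formV, hv, inv_smul_smul₀ hβ, star_mul_cancel hΨ1]
  · have hnu : (du n x).re = 0 := re_fderiv_eq_zero h.re_eq_zero hn _
    have hnv : (dv n x).re = 0 := re_fderiv_eq_zero h.re_eq_zero hn _
    rw [← imDet_mul_right hnu hnv (h.re_eq_zero x) (h.unit x)
      (inner_fderiv_self_eq_zero h.unit hn _) (inner_fderiv_self_eq_zero h.unit hn _), hu, hv,
      imDet_smul_smul]
    have : (1 - s x ^ 2) * ((1 - s x) * (1 + s x) *
        imDet (star (Ψ x) * du Ψ x) (star (Ψ x) * dv Ψ x) (n x)) =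
        ((1 - s x) * (1 + s x)) ^ 2 * imDet (star (Ψ x) * du Ψ x) (star (Ψ x) * dv Ψ x) (n x) := by
      ring
    rw [this]
    positivity

/-- Makes smoothness of `K` a consequence of being realized rather than an assumption. -/
theorem contDiffAt_extrinsicCurvature (hΨ : ContDiffAt ℝ ∞ Ψ x) (hN : ContDiffAt ℝ ∞ N x)
    (h0 : formDet (firstForm Ψ x) ≠ 0) :
    ContDiffAt ℝ ∞ (fun y => extrinsicCurvature Ψ N y) x := by
  have h1 : ∀ X, ContDiffAt ℝ ∞ (fun y => fderiv ℝ Ψ y X) x := fun X =>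
    (hΨ.fderiv_right (m := ∞) (by simp)).clm_apply contDiffAt_const
  have h2 : ∀ X, ContDiffAt ℝ ∞ (fun y => -fderiv ℝ N y X) x := fun X =>
    ((hN.fderiv_right (m := ∞) (by simp)).clm_apply contDiffAt_const).neg
  have e1 : ∀ X Y, ContDiffAt ℝ ∞ (fun y => firstForm Ψ y X Y) x := fun X Y =>
    (h1 X).inner ℝ (h1 Y)
  have e2 : ∀ X Y, ContDiffAt ℝ ∞ (fun y => secondForm Ψ N y X Y) x := fun X Y =>
    (h2 X).inner ℝ (h1 Y)
  exact ContDiffAt.div (((e2 _ _).mul (e2 _ _)).sub ((e2 _ _).mul (e2 _ _)))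
    (((e1 _ _).mul (e1 _ _)).sub ((e1 _ _).mul (e1 _ _))) h0

end Charts

end LorentzGauss
end

noncomputable section

open Set Filter

namespace LorentzGauss

/-! ### The Riemann sphere as the unit sphere, and the change of coordinate at infinity. -/

section SphereCoordinates

/-- Inverse of the stereographic projection of the sphere of unit imaginary quaternions. -/
def sphereNormal (z : OnePoint ℂ) : ℍ[ℝ] := z.elim northPole invStereo

@[simp] theorem sphereNormal_infty : sphereNormal OnePoint.infty = northPole := rfl

@[simp] theorem sphereNormal_coe (w : ℂ) : sphereNormal (w : OnePoint ℂ) = invStereo w := rfl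

theorem sphereNormal_re (z : OnePoint ℂ) : (sphereNormal z).re = 0 := by
  induction z using OnePoint.rec <;> simp

theorem inner_sphereNormal_self (z : OnePoint ℂ) :
    inner ℝ (sphereNormal z) (sphereNormal z) = (1 : ℝ) := by
  induction z using OnePoint.rec with
  | infty => rw [inner_eq_components]; simp
  | coe w => exact inner_invStereo_self w

theorem re_add_I_mul (a b : ℝ) : ((a : ℂ) + Complex.I * b).re = a := by simp

theorem im_add_I_mul (a b : ℝ) : ((a : ℂ) + Complex.I * b).im = b := by simp

theorem stereo_sphereNormal (z : OnePoint ℂ) : stereo (sphereNormal z) = z := by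
  induction z using OnePoint.rec with
  | infty => simp [stereo]
  | coe w =>
    have hr : 1 + w.re ^ 2 + w.im ^ 2 ≠ 0 := by positivity
    have h1 : (invStereo w).imK ≠ 1 := by
      rw [invStereo_imK]
      intro h
      rw [div_eq_one_iff_eq hr] at h
      linarith
    rw [sphereNormal_coe, stereo, if_neg h1]
    congr 1
    have h2 : (1 : ℂ) - ((invStereo w).imK : ℂ) =
        ((2 / (1 + w.re ^ 2 + w.im ^ 2) : ℝ) : ℂ) := by
      rw [invStereo_imK, ← Complex.ofReal_one, ← Complex.ofReal_sub]
      congr 1; field_simp; ring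
    rw [h2]
    apply Complex.ext
    · rw [Complex.div_ofReal_re, re_add_I_mul, invStereo_imI]; field_simp
    · rw [Complex.div_ofReal_im, im_add_I_mul, invStereo_imJ]; field_simp

theorem sphereNormal_stereo {n : ℍ[ℝ]} (hn : n.re = 0) (h1 : inner ℝ n n = (1 : ℝ)) :
    sphereNormal (stereo n) = n := by
  rw [inner_eq_components, hn] at h1
  by_cases h : n.imK = 1
  · rw [stereo, if_pos h, sphereNormal_infty]
    rw [h] at h1
    have hI : n.imI = 0 := by nlinarith [sq_nonneg n.imI, sq_nonneg n.imJ]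
    have hJ : n.imJ = 0 := by nlinarith [sq_nonneg n.imI, sq_nonneg n.imJ]
    ext <;> simp [hn, h, hI, hJ]
  · rw [stereo, if_neg h, sphereNormal_coe]
    have hk : 1 - n.imK ≠ 0 := sub_ne_zero.2 (Ne.symm h)
    have hd : (1 - n.imK : ℂ) = ((1 - n.imK : ℝ) : ℂ) := by push_cast; rfl
    obtain ⟨w, hw⟩ : ∃ w : ℂ, w = (n.imI + Complex.I * n.imJ) / (1 - n.imK) := ⟨_, rfl⟩
    have hre : w.re = n.imI / (1 - n.imK) := by
      rw [hw, hd, Complex.div_ofReal_re]; simp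
    have him : w.im = n.imJ / (1 - n.imK) := by
      rw [hw, hd, Complex.div_ofReal_im]; simp
    rw [← hw]
    have hr : 1 + w.re ^ 2 + w.im ^ 2 = 2 / (1 - n.imK) := by
      rw [hre, him]; field_simp; linarith
    have hr' : w.re ^ 2 + w.im ^ 2 = 2 / (1 - n.imK) - 1 := by linarith
    ext
    · simp [hn]
    · rw [invStereo_imI, hr, hre]; field_simp
    · rw [invStereo_imJ, hr, him]; field_simp
    · rw [invStereo_imK, hr, hr']; field_simp; ring

/-- The rotation of the sphere corresponding to the change of coordinate `z ↦ 1 / z`, and the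
identity when `c` is finite. -/
def poleRotation (c : OnePoint ℂ) : ℍ[ℝ] →L[ℝ] ℍ[ℝ] :=
  c.elim ((ContinuousLinearMap.mul ℝ ℍ[ℝ] unitI).comp
    ((ContinuousLinearMap.mul ℝ ℍ[ℝ]).flip (-unitI))) fun _ => ContinuousLinearMap.id ℝ ℍ[ℝ]

theorem poleRotation_infty (q : ℍ[ℝ]) :
    poleRotation OnePoint.infty q = unitI * (q * -unitI) := rfl

theorem unitI_mul_self : unitI * unitI = -1 := by ext <;> simp

/-- Conjugation by the unit `i` is an algebra automorphism, so it commutes with the products in the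
tension defect. -/
theorem poleRotation_mul (c : OnePoint ℂ) (a b : ℍ[ℝ]) :
    poleRotation c (a * b) = poleRotation c a * poleRotation c b := by
  induction c using OnePoint.rec with
  | infty =>
    simp only [poleRotation_infty]
    calc unitI * (a * b * -unitI) = -(unitI * a * (-1) * (b * -unitI)) := by noncomm_ring
      _ = _ := by rw [← unitI_mul_self]; noncomm_ring
  | coe w => rfl

theorem poleRotation_injective (c : OnePoint ℂ) : Function.Injective (poleRotation c) := by
  induction c using OnePoint.rec with
  | infty =>
    rw [injective_iff_map_eq_zero]
    intro q hq
    have h0 : unitI ≠ 0 := fun h => by simpa using congrArg (fun q : ℍ[ℝ] => q.imI) h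
    simpa [poleRotation_infty, h0] using hq
  | coe w => exact fun a b h => h

theorem imDet_poleRotation (c : OnePoint ℂ) (a b n : ℍ[ℝ]) :
    imDet (poleRotation c a) (poleRotation c b) (poleRotation c n) = imDet a b n := by
  induction c using OnePoint.rec with
  | infty => simp [poleRotation_infty, imDet, Matrix.det_fin_three]
  | coe w => rfl

/-- The half turn about the `i` axis induces `z ↦ 1 / z`. The hypotheses exclude the one point at
which `sphereCoord` takes a meaningless default value: `0` for the coordinate `1 / z`, and `∞` for
the coordinate `z`. -/
theorem sphereNormal_eq_poleRotation {c z : OnePoint ℂ}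
    (h₁ : c = OnePoint.infty → z ≠ ((0 : ℂ) : OnePoint ℂ))
    (h₂ : c ≠ OnePoint.infty → z ≠ OnePoint.infty) :
    sphereNormal z = poleRotation c (invStereo (sphereCoord c z)) := by
  induction c using OnePoint.rec with
  | infty =>
    have h := h₁ rfl
    induction z using OnePoint.rec with
    | infty =>
      rw [poleRotation_infty]
      ext <;> simp [sphereCoord]
    | coe w =>
      have hw : w ≠ 0 := fun h0 => h (by rw [h0])
      have hs : w.re ^ 2 + w.im ^ 2 ≠ 0 := by
        have := Complex.normSq_pos.2 hw
        rw [Complex.normSq_apply] at this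
        nlinarith
      have hr : 1 + w.re ^ 2 + w.im ^ 2 ≠ 0 := by positivity
      have e : sphereCoord OnePoint.infty (w : OnePoint ℂ) = w⁻¹ := rfl
      have hre : (w⁻¹).re = w.re / (w.re ^ 2 + w.im ^ 2) := by
        rw [Complex.inv_re, Complex.normSq_apply, sq, sq]
      have him : (w⁻¹).im = -w.im / (w.re ^ 2 + w.im ^ 2) := by
        rw [Complex.inv_im, Complex.normSq_apply, sq, sq]
      have hr1 : 1 + (w⁻¹).re ^ 2 + (w⁻¹).im ^ 2 =
          (1 + w.re ^ 2 + w.im ^ 2) / (w.re ^ 2 + w.im ^ 2) := by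
        rw [hre, him]; field_simp; ring
      have hr2 : (w⁻¹).re ^ 2 + (w⁻¹).im ^ 2 - 1 =
          (1 - w.re ^ 2 - w.im ^ 2) / (w.re ^ 2 + w.im ^ 2) := by
        rw [hre, him]; field_simp; ring
      rw [e, poleRotation_infty, sphereNormal_coe]
      ext
      · simp
      · have : (unitI * (invStereo w⁻¹ * -unitI)).imI = (invStereo w⁻¹).imI := by simp
        rw [this, invStereo_imI, invStereo_imI, hr1, hre]; field_simp
      · have : (unitI * (invStereo w⁻¹ * -unitI)).imJ = -(invStereo w⁻¹).imJ := by simp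
        rw [this, invStereo_imJ, invStereo_imJ, hr1, him]; field_simp
      · have : (unitI * (invStereo w⁻¹ * -unitI)).imK = -(invStereo w⁻¹).imK := by simp
        rw [this, invStereo_imK, invStereo_imK, hr1, hr2]; field_simp; ring
  | coe c =>
    have h := h₂ (OnePoint.coe_ne_infty c)
    induction z using OnePoint.rec with
    | infty => exact absurd rfl h
    | coe w => rfl

theorem fderiv_clm_comp_apply {f : ℝ × ℝ → ℍ[ℝ]} {x : ℝ × ℝ} (T : ℍ[ℝ] →L[ℝ] ℍ[ℝ])
    (hf : DifferentiableAt ℝ f x) (X : ℝ × ℝ) :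
    fderiv ℝ (fun y => T (f y)) x X = T (fderiv ℝ f x X) := by
  have : HasFDerivAt (fun y => T (f y)) _ x := T.hasFDerivAt.comp x hf.hasFDerivAt
  rw [this.fderiv]; rfl

theorem tensionDefect_clm_comp {m : ℝ × ℝ → ℍ[ℝ]} {s : ℝ × ℝ → ℝ} {x : ℝ × ℝ}
    {T : ℍ[ℝ] →L[ℝ] ℍ[ℝ]} (hT : ∀ a b, T (a * b) = T a * T b) (hm : ContDiffAt ℝ ∞ m x) :
    tensionDefect (fun y => T (m y)) s x = T (tensionDefect m s x) := by
  have hd := hm.differentiableAt (by simp)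
  have e : du (fun y => T (m y)) =ᶠ[𝓝 x] fun y => T (du m y) := by
    have : ∀ᶠ y in 𝓝 x, DifferentiableAt ℝ m y :=
      (hm.of_le (m := 1) (by simp) |>.eventually (by simp)).mono
        fun y hy => hy.differentiableAt (by simp)
    exact this.mono fun y hy => fderiv_clm_comp_apply T hy _
  have e1 : dv (du fun y => T (m y)) x = T (dv (du m) x) := by
    rw [dv, e.fderiv_eq, fderiv_clm_comp_apply T ((contDiffAt_du hm).differentiableAt (by simp))]
    rfl
  have e2 : dv (fun y => T (m y)) x = T (dv m x) := fderiv_clm_comp_apply T hd _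
  simp only [tensionDefect, e1, e.eq_of_nhds, e2, map_sub, map_smul, map_add, hT]

theorem tensionDefect_congr {m m' : ℝ × ℝ → ℍ[ℝ]} {s : ℝ × ℝ → ℝ} {x : ℝ × ℝ}
    (h : m' =ᶠ[𝓝 x] m) : tensionDefect m' s x = tensionDefect m s x := by
  have e : fderiv ℝ m' =ᶠ[𝓝 x] fderiv ℝ m := h.fderiv
  have e1 : du m' =ᶠ[𝓝 x] du m := e.mono fun y hy => by simp only [du, hy]
  have e2 : dv (du m') x = dv (du m) x := by simp only [dv, e1.fderiv_eq]
  have e3 : dv m' x = dv m x := by simp only [dv, h.fderiv_eq]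
  simp only [tensionDefect, e2, e3, e1.eq_of_nhds, h.eq_of_nhds]

end SphereCoordinates

end LorentzGauss
end

noncomputable section

set_option linter.unusedSectionVars false

open Set Filter

namespace LorentzGauss

/-! ### From charts to the surface: local solutions, gluing and realizations. -/

section Manifold

variable {S : Type*} [TopologicalSpace S] [ChartedSpace (ℝ × ℝ) S]
variable {F : Type*} [NormedAddCommGroup F] [NormedSpace ℝ F]
variable {e : OpenPartialHomeomorph S (ℝ × ℝ)} {p : S}

theorem contDiffAt_comp_symm [IsManifold 𝓘(ℝ, ℝ × ℝ) ∞ S] {f : S → F}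
    (he : e ∈ atlas (ℝ × ℝ) S) (hp : p ∈ e.source)
    (hf : ContMDiffAt 𝓘(ℝ, ℝ × ℝ) 𝓘(ℝ, F) ∞ f p) :
    ContDiffAt ℝ ∞ (fun x => f (e.symm x)) (e p) := by
  rw [← contMDiffAt_iff_contDiffAt]
  have h1 : ContMDiffAt 𝓘(ℝ, ℝ × ℝ) 𝓘(ℝ, ℝ × ℝ) ∞ e.symm (e p) :=
    contMDiffAt_symm_of_mem_maximalAtlas (IsManifold.subset_maximalAtlas he) (e.map_source hp)
  exact ContMDiffAt.comp (e p) (g := f) (by rwa [e.left_inv hp]) h1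

theorem contMDiffAt_of_comp_symm [IsManifold 𝓘(ℝ, ℝ × ℝ) ∞ S] {f : S → F}
    (he : e ∈ atlas (ℝ × ℝ) S) (hp : p ∈ e.source)
    (hf : ContDiffAt ℝ ∞ (fun x => f (e.symm x)) (e p)) :
    ContMDiffAt 𝓘(ℝ, ℝ × ℝ) 𝓘(ℝ, F) ∞ f p := by
  have h1 : ContMDiffAt 𝓘(ℝ, ℝ × ℝ) 𝓘(ℝ, ℝ × ℝ) ∞ e p :=
    contMDiffAt_of_mem_maximalAtlas (IsManifold.subset_maximalAtlas he) hp
  have h2 := ContMDiffAt.comp p (contMDiffAt_iff_contDiffAt.2 hf) h1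
  refine h2.congr_of_eventuallyEq ?_
  filter_upwards [e.open_source.mem_nhds hp] with q hq
  simp [e.left_inv hq]

theorem eventually_chart (hp : p ∈ e.source) {P : S → Prop} (h : ∀ᶠ q in 𝓝 p, P q) :
    ∀ᶠ x in 𝓝 (e p), P (e.symm x) := by
  have : Tendsto e.symm (𝓝 (e p)) (𝓝 p) := by
    have := e.symm.continuousAt (x := e p) (e.map_source hp)
    rwa [ContinuousAt, e.left_inv hp] at this
  exact this.eventually h

theorem mfderiv_eq_fderiv_chart {f : S → F}
    (hf : MDifferentiableAt 𝓘(ℝ, ℝ × ℝ) 𝓘(ℝ, F) f p) :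
    ∀ X : ℝ × ℝ, (mfderiv 𝓘(ℝ, ℝ × ℝ) 𝓘(ℝ, F) f p : (ℝ × ℝ) → F) X =
      fderiv ℝ (fun x => f ((chartAt (ℝ × ℝ) p).symm x)) (chartAt (ℝ × ℝ) p p) X := by
  intro X
  rw [hf.mfderiv]
  simp [writtenInExtChartAt, Function.comp_def, mfld_simps]
  rfl

/-- The left translated normal in a chart. -/
def chartNormal (g : S → OnePoint ℂ) (e : OpenPartialHomeomorph S (ℝ × ℝ)) (x : ℝ × ℝ) : ℍ[ℝ] :=
  sphereNormal (g (e.symm x))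

/-- The square root of minus the extrinsic curvature in a chart. -/
def chartSqrt (K : S → ℝ) (e : OpenPartialHomeomorph S (ℝ × ℝ)) (x : ℝ × ℝ) : ℝ :=
  √(-K (e.symm x))

variable {g : S → OnePoint ℂ} {K : S → ℝ}

theorem isGaussData_chart (g : S → OnePoint ℂ) (hK : ∀ p, K p < 0 ∧ K p ≠ -1)
    (e : OpenPartialHomeomorph S (ℝ × ℝ)) : IsGaussData (chartNormal g e) (chartSqrt K e) where
  re_eq_zero _ := sphereNormal_re _
  unit _ := inner_sphereNormal_self _
  pos _ := Real.sqrt_pos.2 (by linarith [(hK (e.symm ‹_›)).1])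
  ne_one y h := by
    rw [chartSqrt, Real.sqrt_eq_one] at h
    exact (hK (e.symm y)).2 (by linarith)

theorem chartSqrt_sq (hK : ∀ p, K p < 0 ∧ K p ≠ -1) (e : OpenPartialHomeomorph S (ℝ × ℝ))
    (x : ℝ × ℝ) : chartSqrt K e x ^ 2 = -K (e.symm x) :=
  Real.sq_sqrt (by linarith [(hK (e.symm x)).1])

/-- Continuity of `g` keeps nearby values away from the point omitted by the coordinate chosen at
`p`. -/
theorem eventually_sphereNormal_eq (hg : SmoothToSphere g) (p : S) :
    ∀ᶠ q in 𝓝 p, sphereNormal (g q) = poleRotation (g p) (invStereo (sphereCoord (g p) (g q))) := by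
  have h1 : ∀ᶠ q in 𝓝 p, g p = OnePoint.infty → g q ≠ ((0 : ℂ) : OnePoint ℂ) := by
    by_cases h : g p = OnePoint.infty
    · have : g p ≠ ((0 : ℂ) : OnePoint ℂ) := by rw [h]; exact OnePoint.infty_ne_coe 0
      exact (hg.1.continuousAt.eventually_ne this).mono fun q hq _ => hq
    · exact Eventually.of_forall fun q h' => (h h').elim
  have h2 : ∀ᶠ q in 𝓝 p, g p ≠ OnePoint.infty → g q ≠ OnePoint.infty := by
    by_cases h : g p = OnePoint.infty
    · exact Eventually.of_forall fun q h' => (h' h).elim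
    · exact (hg.1.continuousAt.eventually_ne h).mono fun q hq _ => hq
  filter_upwards [h1, h2] with q hq1 hq2
  exact sphereNormal_eq_poleRotation hq1 hq2

variable [LorentzSurface S]

theorem contDiffAt_coord (hg : SmoothToSphere g) (he : e ∈ atlas (ℝ × ℝ) S) (hp : p ∈ e.source) :
    ContDiffAt ℝ ∞ (fun x => sphereCoord (g p) (g (e.symm x))) (e p) :=
  contDiffAt_comp_symm (f := fun q => sphereCoord (g p) (g q)) he hp (hg.2 p)

theorem chartNormal_eventuallyEq (hg : SmoothToSphere g) (hp : p ∈ e.source) :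
    chartNormal g e =ᶠ[𝓝 (e p)]
      fun x => poleRotation (g p) (invStereo (sphereCoord (g p) (g (e.symm x)))) :=
  eventually_chart hp (eventually_sphereNormal_eq hg p)

theorem contDiffAt_chartNormal (hg : SmoothToSphere g) (he : e ∈ atlas (ℝ × ℝ) S)
    (hp : p ∈ e.source) : ContDiffAt ℝ ∞ (chartNormal g e) (e p) :=
  ((poleRotation (g p)).contDiff.contDiffAt.comp (e p)
    (contDiff_invStereo.contDiffAt.comp (e p) (contDiffAt_coord hg he hp))).congr_of_eventuallyEq
      (chartNormal_eventuallyEq hg hp)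

theorem contDiffAt_chartSqrt (hK : ∀ p, K p < 0 ∧ K p ≠ -1)
    (hKs : ContMDiff 𝓘(ℝ, ℝ × ℝ) 𝓘(ℝ, ℝ) ∞ K) (he : e ∈ atlas (ℝ × ℝ) S) (hp : p ∈ e.source) :
    ContDiffAt ℝ ∞ (chartSqrt K e) (e p) :=
  (contDiffAt_comp_symm he hp (hKs p)).neg.sqrt (by linarith [(hK (e.symm (e p))).1])

/-- The rotation preserves the determinant and the conformal factor is positive, so only the
orientation reversal of the projection remains and flips the inequality. -/
theorem signCondition_iff (hg : SmoothToSphere g) (he : e ∈ atlas (ℝ × ℝ) S) (hp : p ∈ e.source) :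
    (1 + K p) * gaussJacobian (fun x => sphereCoord (g p) (g (e.symm x))) (e p) < 0 ↔
      0 < (1 + K p) * imDet (du (chartNormal g e) (e p)) (dv (chartNormal g e) (e p))
        (chartNormal g e (e p)) := by
  set w : ℝ × ℝ → ℂ := fun x => sphereCoord (g p) (g (e.symm x)) with hw
  have hwd : DifferentiableAt ℝ w (e p) := (contDiffAt_coord hg he hp).differentiableAt (by simp)
  have hev := chartNormal_eventuallyEq hg hp
  have hid : DifferentiableAt ℝ (fun x => invStereo (w x)) (e p) :=
    (contDiff_invStereo.differentiable (by simp) _).comp (e p) hwd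
  have eu : du (chartNormal g e) (e p) =
      poleRotation (g p) (du (fun x => invStereo (w x)) (e p)) := by
    rw [du, hev.fderiv_eq, fderiv_clm_comp_apply _ hid]; rfl
  have ev : dv (chartNormal g e) (e p) =
      poleRotation (g p) (dv (fun x => invStereo (w x)) (e p)) := by
    rw [dv, hev.fderiv_eq, fderiv_clm_comp_apply _ hid]; rfl
  rw [eu, ev, hev.eq_of_nhds, imDet_poleRotation, imDet_invStereo hwd]
  have hr : 0 < 2 / (1 + (w (e p)).re ^ 2 + (w (e p)).im ^ 2) ^ 2 := by positivity
  rw [show (1 + K p) * (-(2 / (1 + (w (e p)).re ^ 2 + (w (e p)).im ^ 2) ^ 2) *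
    gaussJacobian w (e p)) = 2 / (1 + (w (e p)).re ^ 2 + (w (e p)).im ^ 2) ^ 2 *
      -((1 + K p) * gaussJacobian w (e p)) by ring, mul_pos_iff_of_pos_left hr, neg_pos]

theorem integrability_iff (hg : SmoothToSphere g) (hK : ∀ p, K p < 0 ∧ K p ≠ -1)
    (hKs : ContMDiff 𝓘(ℝ, ℝ × ℝ) 𝓘(ℝ, ℝ) ∞ K) (he : e ∈ atlas (ℝ × ℝ) S) (hp : p ∈ e.source)
    (hsign : (1 + K p) * gaussJacobian (fun x => sphereCoord (g p) (g (e.symm x))) (e p) < 0) :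
    (IntegrabilityU (fun x => sphereCoord (g p) (g (e.symm x))) (fun x => K (e.symm x)) (e p) ∧
      IntegrabilityV (fun x => sphereCoord (g p) (g (e.symm x))) (fun x => K (e.symm x)) (e p)) ↔
    tensionDefect (chartNormal g e) (chartSqrt K e) (e p) = 0 := by
  have hw := contDiffAt_coord hg he hp
  rw [integrability_iff_tensionDefect hw
    ((contDiffAt_comp_symm he hp (hKs p)).differentiableAt (by simp)) (fun y => (hK _).1)
    (by simpa [e.left_inv hp] using (hK p).2) (right_ne_zero_of_mul hsign.ne),
    tensionDefect_congr (chartNormal_eventuallyEq hg hp),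
    tensionDefect_clm_comp (m := fun x => invStereo (sphereCoord (g p) (g (e.symm x))))
      (poleRotation_mul (g p)) (contDiff_invStereo.contDiffAt.comp (e p) hw),
    map_eq_zero_iff _ (poleRotation_injective (g p))]
  rfl

/-- `ψ` solves the structure equation at `p` in all charts. -/
def IsSolutionAt (g : S → OnePoint ℂ) (K : S → ℝ) (ψ : S → S3) (p : S) : Prop :=
  ∀ e ∈ atlas (ℝ × ℝ) S, p ∈ e.source →
    IsParallelAt (chartNormal g e) (chartSqrt K e) (fun x => (ψ (e.symm x) : ℍ[ℝ])) (e p)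

theorem norm_coe_S3 (q : S3) : ‖(q : ℍ[ℝ])‖ = 1 := norm_eq_of_mem_sphere q

/-- The structure equation in one chart implies the structure equation in all charts. -/
theorem isSolutionAt_of_chart (hg : SmoothToSphere g) {ψ : S → S3} (he : e ∈ atlas (ℝ × ℝ) S)
    (hp : p ∈ e.source)
    (h : IsParallelAt (chartNormal g e) (chartSqrt K e) (fun x => (ψ (e.symm x) : ℍ[ℝ])) (e p)) :
    IsSolutionAt g K ψ p := by
  intro e' he' hp'
  have hτp : e (e'.symm (e' p)) = e p := by rw [e'.left_inv hp']
  have hτ : ContDiffAt ℝ ∞ (fun x => e (e'.symm x)) (e' p) :=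
    contDiffAt_comp_symm he' hp'
      (contMDiffAt_of_mem_maximalAtlas (IsManifold.subset_maximalAtlas he) hp)
  have hsrc : e' p ∈ (e'.symm.trans e).source := by
    rw [OpenPartialHomeomorph.trans_source]
    exact ⟨e'.map_source hp', by simpa [e'.left_inv hp'] using hp⟩
  obtain ⟨h1, h2, -⟩ := LorentzSurface.null_transition e' he' e he (e' p) hsrc
  have hpar := IsParallelAt.comp_null (τ := fun x => e (e'.symm x)) (x := e' p)
    (n := chartNormal g e) (s := chartSqrt K e) (Ψ := fun x => (ψ (e.symm x) : ℍ[ℝ]))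
    (by rw [hτp]; exact h)
    (by rw [hτp]; exact (contDiffAt_chartNormal hg he hp).differentiableAt (by simp))
    (hτ.differentiableAt (by simp)) h2 h1
  -- Composing the transition map with the first chart recovers the second only near the point,
  -- which suffices since the structure equation is local.
  have hev : ∀ᶠ x in 𝓝 (e' p), e.symm (e (e'.symm x)) = e'.symm x :=
    eventually_chart hp' (Filter.mem_of_superset (e.open_source.mem_nhds hp) fun q hq => e.left_inv hq)
  exact hpar.congr (hev.mono fun x hx => by simp only [chartNormal, hx])
    (hev.mono fun x hx => by simp only [chartSqrt, hx]) (hev.mono fun x hx => by simp only [hx])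

theorem eventually_isParallelAt {ψ : S → S3} (he : e ∈ atlas (ℝ × ℝ) S) (hp : p ∈ e.source)
    (h : ∀ᶠ q in 𝓝 p, IsSolutionAt g K ψ q) : ∀ᶠ x in 𝓝 (e p),
      IsParallelAt (chartNormal g e) (chartSqrt K e) (fun x => (ψ (e.symm x) : ℍ[ℝ])) x := by
  filter_upwards [eventually_chart hp h, e.open_target.mem_nhds (e.map_source hp)] with x hx hxt
  have := hx e he (e.map_target hxt)
  rwa [e.right_inv hxt] at this

theorem eventually_mul_inv_eq (hg : SmoothToSphere g) (hK : ∀ p, K p < 0 ∧ K p ≠ -1)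
    {ψ₁ ψ₂ : S → S3} (h₁ : ∀ᶠ q in 𝓝 p, IsSolutionAt g K ψ₁ q)
    (h₂ : ∀ᶠ q in 𝓝 p, IsSolutionAt g K ψ₂ q) :
    ∀ᶠ q in 𝓝 p, ψ₂ q * (ψ₁ q)⁻¹ = ψ₂ p * (ψ₁ p)⁻¹ := by
  have he := chart_mem_atlas (ℝ × ℝ) p
  have hp := mem_chart_source (ℝ × ℝ) p
  set e := chartAt (ℝ × ℝ) p
  have hn : ∀ᶠ x in 𝓝 (e p), DifferentiableAt ℝ (chartNormal g e) x := by
    filter_upwards [e.open_target.mem_nhds (e.map_source hp)] with x hx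
    have := contDiffAt_chartNormal hg he (e.map_target hx)
    rw [e.right_inv hx] at this
    exact this.differentiableAt (by simp)
  have hc := eventually_mul_star_eq (isGaussData_chart g hK e) hn
    (eventually_isParallelAt he hp h₁) (eventually_isParallelAt he hp h₂)
  have hc' : ∀ᶠ q in 𝓝 p, _ := (e.continuousAt hp).eventually hc
  filter_upwards [hc', e.open_source.mem_nhds hp] with q hq hqs
  simp only [e.left_inv hqs, e.left_inv hp] at hq
  apply Subtype.ext
  simpa [inv_eq_star_of_norm_one (norm_coe_S3 _)] using hq

/-- Two global solutions differ by a left translation. -/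
theorem exists_left_translation [PreconnectedSpace S] [Nonempty S] (hg : SmoothToSphere g)
    (hK : ∀ p, K p < 0 ∧ K p ≠ -1) {ψ₁ ψ₂ : S → S3} (h₁ : ∀ q, IsSolutionAt g K ψ₁ q)
    (h₂ : ∀ q, IsSolutionAt g K ψ₂ q) : ∃ a : S3, ∀ p, ψ₂ p = a * ψ₁ p := by
  have hl : IsLocallyConstant fun q => ψ₂ q * (ψ₁ q)⁻¹ :=
    (IsLocallyConstant.iff_eventually_eq _).2 fun p =>
      eventually_mul_inv_eq hg hK (Eventually.of_forall h₁) (Eventually.of_forall h₂)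
  obtain ⟨p₀⟩ := ‹Nonempty S›
  refine ⟨ψ₂ p₀ * (ψ₁ p₀)⁻¹, fun p => ?_⟩
  rw [← hl.apply_eq_of_preconnectedSpace p p₀]
  simp

theorem IsSolutionAt.const_mul {ψ : S → S3} (h : IsSolutionAt g K ψ p) (c : S3) :
    IsSolutionAt g K (fun q => c * ψ q) p := fun e he hp => by
  simpa using (h e he hp).const_mul (c : ℍ[ℝ])

theorem IsSolutionAt.congr {ψ ψ' : S → S3} (h : IsSolutionAt g K ψ p) (h' : ψ' =ᶠ[𝓝 p] ψ) :
    IsSolutionAt g K ψ' p := fun e he hp =>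
  (h e he hp).congr EventuallyEq.rfl EventuallyEq.rfl
    ((eventually_chart hp h').mono fun x hx => by simp only [hx])

/-- Local solvability of the structure equation on the surface. -/
theorem exists_local_solution (hg : SmoothToSphere g) (hK : ∀ p, K p < 0 ∧ K p ≠ -1)
    (hKs : ContMDiff 𝓘(ℝ, ℝ × ℝ) 𝓘(ℝ, ℝ) ∞ K) (hS : SignCondition g K)
    (hI : SolvesIntegrability g K) (p : S) :
    ∃ (V : Set S) (φ : S → S3), IsOpen V ∧ p ∈ V ∧ ∀ q ∈ V, IsSolutionAt g K φ q := by
  have he := chart_mem_atlas (ℝ × ℝ) p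
  have hp := mem_chart_source (ℝ × ℝ) p
  set e := chartAt (ℝ × ℝ) p
  have ht : ∀ᶠ x in 𝓝 (e p), x ∈ e.target := e.open_target.mem_nhds (e.map_source hp)
  have hn : ∀ᶠ x in 𝓝 (e p), ContDiffAt ℝ ∞ (chartNormal g e) x := ht.mono fun x hx => by
    simpa [e.right_inv hx] using contDiffAt_chartNormal hg he (e.map_target hx)
  have hs : ∀ᶠ x in 𝓝 (e p), ContDiffAt ℝ ∞ (chartSqrt K e) x := ht.mono fun x hx => by
    simpa [e.right_inv hx] using contDiffAt_chartSqrt hK hKs he (e.map_target hx)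
  have hT : ∀ᶠ x in 𝓝 (e p), tensionDefect (chartNormal g e) (chartSqrt K e) x = 0 :=
    ht.mono fun x hx => by
      have := (integrability_iff hg hK hKs he (e.map_target hx) (hS e he _ (e.map_target hx))).1
        (hI e he _ (e.map_target hx))
      rwa [e.right_inv hx] at this
  obtain ⟨φ, hφ⟩ := (isGaussData_chart g hK e).exists_isParallelAt hn hs hT
  obtain ⟨W, hW, hWo, hpW⟩ := eventually_nhds_iff.1 (hφ.and ht)
  classical
  let ψ : S → S3 := fun q => if h : ‖φ (e q)‖ = 1 then ⟨φ (e q), by simpa using h⟩ else 1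
  have hψ : ∀ x ∈ W, (ψ (e.symm x) : ℍ[ℝ]) = φ x := by
    intro x hx
    obtain ⟨⟨-, h1⟩, hxt⟩ := hW x hx
    have h2 : ‖φ (e (e.symm x))‖ = 1 := by rw [e.right_inv hxt]; exact h1
    simp only [ψ, dif_pos h2, e.right_inv hxt]
  refine ⟨e.source ∩ e ⁻¹' W, ψ, e.isOpen_inter_preimage hWo, ⟨hp, hpW⟩, fun q hq => ?_⟩
  refine isSolutionAt_of_chart hg he hq.1 ?_
  refine (hW _ hq.2).1.1.congr EventuallyEq.rfl EventuallyEq.rfl ?_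
  filter_upwards [hWo.mem_nhds hq.2] with x hx
  exact hψ x hx

/-- Global solvability of the structure equation on a simply connected surface. -/
theorem exists_global_solution [SimplyConnectedSpace S] (hg : SmoothToSphere g)
    (hK : ∀ p, K p < 0 ∧ K p ≠ -1) (hKs : ContMDiff 𝓘(ℝ, ℝ × ℝ) 𝓘(ℝ, ℝ) ∞ K)
    (hS : SignCondition g K) (hI : SolvesIntegrability g K) :
    ∃ ψ : S → S3, ∀ p, IsSolutionAt g K ψ p := by
  have : LocallyPathConnectedSpace S := ChartedSpace.locallyPathConnectedSpace (ℝ × ℝ) S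
  choose V φ hVo hpV hφ using exists_local_solution hg hK hKs hS hI
  obtain ⟨ψ, hψ⟩ := exists_global_section V hVo (fun x => ⟨x, hpV x⟩) φ (fun i j x hx =>
    eventually_mul_inv_eq hg hK
      (Filter.mem_of_superset ((hVo j).mem_nhds hx.2) fun q hq => hφ j q hq)
      (Filter.mem_of_superset ((hVo i).mem_nhds hx.1) fun q hq => hφ i q hq))
  -- Near `p` the glued map is a constant left multiple of the local solution `φ p`, and left
  -- multiples of solutions are solutions.
  refine ⟨ψ, fun p => ((hφ p p (hpV p)).const_mul (ψ p * (φ p p)⁻¹)).congr ?_⟩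
  filter_upwards [hψ p p (hpV p)] with q hq
  rw [← hq]; simp

/-- The immersion of a realization solves the structure equation. -/
theorem IsRealization.isSolutionAt (hg : SmoothToSphere g) (hK : ∀ p, K p < 0 ∧ K p ≠ -1)
    {ψ : S → S3} (h : IsRealization g K ψ) : (∀ p, IsSolutionAt g K ψ p) ∧
      (∀ e ∈ atlas (ℝ × ℝ) S, ∀ p ∈ e.source, 0 < (1 + K p) *
        imDet (du (chartNormal g e) (e p)) (dv (chartNormal g e) (e p))
          (chartNormal g e (e p))) ∧
      ContMDiff 𝓘(ℝ, ℝ × ℝ) 𝓘(ℝ, ℝ) ∞ K := by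
  obtain ⟨N, hN, hII, hgauss, hext⟩ := h
  have hnorm : ∀ q, sphereNormal (g q) = star (ψ q : ℍ[ℝ]) * N q := by
    intro q
    have h1 : ‖star (ψ q : ℍ[ℝ])‖ = 1 := by rw [Quaternion.norm_star, norm_coe_S3]
    rw [← hgauss, gaussMap, inv_eq_star_of_norm_one (norm_coe_S3 _)]
    refine sphereNormal_stereo ?_ ?_
    · rw [re_star_mul]; exact hN.normal_tangent q
    · rw [inner_mul_mul_of_norm_one h1, ← norm_eq_one_iff_inner]; exact hN.normal_unit q
  have key : ∀ e ∈ atlas (ℝ × ℝ) S, ∀ p ∈ e.source,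
      (IsParallelAt (chartNormal g e) (chartSqrt K e) (fun x => (ψ (e.symm x) : ℍ[ℝ])) (e p) ∧
        0 < (1 + K p) * imDet (du (chartNormal g e) (e p)) (dv (chartNormal g e) (e p))
          (chartNormal g e (e p))) ∧ ContDiffAt ℝ ∞ (fun x => K (e.symm x)) (e p) := by
    intro e he p hp
    have hΨ : ContDiffOn ℝ ∞ (fun x => (ψ (e.symm x) : ℍ[ℝ])) e.target := fun x hx => by
      have := contDiffAt_comp_symm he (e.map_target hx) (hN.smooth (e.symm x))
      rw [e.right_inv hx] at this
      exact this.contDiffWithinAt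
    have hNs : ContDiffOn ℝ ∞ (fun x => N (e.symm x)) e.target := fun x hx => by
      have := contDiffAt_comp_symm he (e.map_target hx) (hN.normal_smooth (e.symm x))
      rw [e.right_inv hx] at this
      exact this.contDiffWithinAt
    obtain ⟨h11, h22, h12, hD⟩ := hII e he p hp
    have hpe : e.symm (e p) = p := e.left_inv hp
    have hD' : 0 < imDet (star (ψ (e.symm (e p)) : ℍ[ℝ]) * du (fun x => (ψ (e.symm x) : ℍ[ℝ])) (e p))
        (star (ψ (e.symm (e p)) : ℍ[ℝ]) * dv (fun x => (ψ (e.symm x) : ℍ[ℝ])) (e p))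
        (chartNormal g e (e p)) := by
      rw [chartNormal, hpe, hnorm]
      rwa [inv_eq_star_of_norm_one (norm_coe_S3 _)] at hD
    have hs := isGaussData_chart g hK e
    have hcn := (contDiffAt_chartNormal hg he hp).differentiableAt (by simp)
    have hΨx := eventually_contDiffAt e.open_target hΨ (e.map_source hp)
    have hNx := eventually_contDiffAt e.open_target hNs (e.map_source hp)
    obtain ⟨t, ht0, ht, hu, hv⟩ := exists_structure_equation (n := chartNormal g e) e.open_target
      (e.map_source hp) hΨ hNs
      (fun y => norm_coe_S3 _) (fun y => hN.normal_unit _) (fun y => hN.normal_tangent _)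
      (fun y hy X => by
        have := hN.normal_orthogonal e he _ (e.map_target hy) X
        rwa [e.right_inv hy] at this) (fun y => hnorm _) h11 h22 h12 hD'
    rw [hext e he p hp] at ht
    -- Positivity of `t` selects the root: both have square `-K p`.
    have hst : chartSqrt K e (e p) = t := by
      rw [chartSqrt, hpe, ht, neg_neg, Real.sqrt_sq ht0.le]
    rw [← hst] at hu hv
    have hres := isParallelAt_of_structure_equation hs hcn (hΨx.differentiableAt (by simp))
      (norm_coe_S3 _) hu hv hD'
    rw [chartSqrt_sq hK, hpe, sub_neg_eq_add] at hres
    refine ⟨hres, ?_⟩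
    -- The first fundamental form is nondegenerate because `K` is nonzero: a zero determinant would
    -- make the quotient `0` by convention.
    have hEx := contDiffAt_extrinsicCurvature hΨx hNx (by
      intro h0
      have := hext e he p hp
      rw [extrinsicCurvature, h0, div_zero] at this
      exact (hK p).1.ne this.symm)
    refine hEx.congr_of_eventuallyEq ?_
    filter_upwards [e.open_target.mem_nhds (e.map_source hp)] with x hx
    have := hext e he _ (e.map_target hx)
    rw [e.right_inv hx] at this
    exact this.symm
  exact ⟨fun p e he hp => (key e he p hp).1.1, fun e he p hp => (key e he p hp).1.2, fun p =>
    contMDiffAt_of_comp_symm (chart_mem_atlas _ p) (mem_chart_source _ p)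
      (key _ (chart_mem_atlas _ p) p (mem_chart_source _ p)).2⟩

theorem contDiffOn_of_isSolutionAt (hg : SmoothToSphere g) (hK : ∀ p, K p < 0 ∧ K p ≠ -1)
    (hKs : ContMDiff 𝓘(ℝ, ℝ × ℝ) 𝓘(ℝ, ℝ) ∞ K) {ψ : S → S3} (h : ∀ p, IsSolutionAt g K ψ p)
    (he : e ∈ atlas (ℝ × ℝ) S) : ContDiffOn ℝ ∞ (fun x => (ψ (e.symm x) : ℍ[ℝ])) e.target := by
  refine contDiffOn_of_isParallelAt (n := chartNormal g e) (s := chartSqrt K e) e.open_target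
    (fun x hx => ?_) fun x hx => ?_
  · have h1 := contDiffAt_chartNormal hg he (e.map_target hx)
    have h2 := contDiffAt_chartSqrt hK hKs he (e.map_target hx)
    have h3 := (isGaussData_chart g hK e).contDiffAt_connForm h1 h2
    rw [e.right_inv hx] at h3
    exact h3.contDiffWithinAt
  · have := h _ e he (e.map_target hx)
    rwa [e.right_inv hx] at this

/-- The conditions on the Gauss map and the curvature of a realization are necessary. -/
theorem IsRealization.conditions (hg : SmoothToSphere g) (hK : ∀ p, K p < 0 ∧ K p ≠ -1)
    {ψ : S → S3} (h : IsRealization g K ψ) :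
    ContMDiff 𝓘(ℝ, ℝ × ℝ) 𝓘(ℝ, ℝ) ∞ K ∧ SignCondition g K ∧ SolvesIntegrability g K := by
  obtain ⟨hsol, hsign, hKs⟩ := h.isSolutionAt hg hK
  have hS : SignCondition g K := fun e he p hp => (signCondition_iff hg he hp).2 (hsign e he p hp)
  refine ⟨hKs, hS, fun e he p hp => ?_⟩
  refine (integrability_iff hg hK hKs he hp (hS e he p hp)).2 ?_
  refine (isGaussData_chart g hK e).tensionDefect_eq_zero (contDiffAt_chartNormal hg he hp)
    (contDiffAt_chartSqrt hK hKs he hp)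
    (eventually_contDiffAt e.open_target (contDiffOn_of_isSolutionAt hg hK hKs hsol he)
      (e.map_source hp)) ?_ (eventually_isParallelAt he hp (Eventually.of_forall hsol))
  intro h0
  have := norm_coe_S3 (ψ (e.symm (e p)))
  rw [h0, norm_zero] at this
  exact zero_ne_one this

/-- Solutions of the structure equation are realizations. -/
theorem isRealization_of_isSolutionAt (hg : SmoothToSphere g) (hK : ∀ p, K p < 0 ∧ K p ≠ -1)
    (hKs : ContMDiff 𝓘(ℝ, ℝ × ℝ) 𝓘(ℝ, ℝ) ∞ K) (hS : SignCondition g K) {ψ : S → S3}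
    (h : ∀ p, IsSolutionAt g K ψ p) : IsRealization g K ψ := by
  have hinv : ∀ p, (ψ p : ℍ[ℝ])⁻¹ * ((ψ p : ℍ[ℝ]) * sphereNormal (g p)) = sphereNormal (g p) := by
    intro p
    rw [inv_eq_star_of_norm_one (norm_coe_S3 _), ← mul_assoc,
      star_mul_self_of_norm_one (norm_coe_S3 _), one_mul]
  have hgeo : ∀ e ∈ atlas (ℝ × ℝ) S, ∀ p ∈ e.source, _ := fun e he p hp =>
    (h p e he hp).geometry (isGaussData_chart g hK e)
      ((contDiffAt_chartNormal hg he hp).differentiableAt (by simp)) (norm_coe_S3 _) (by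
        rw [chartSqrt_sq hK, e.left_inv hp, sub_neg_eq_add]
        exact (signCondition_iff hg he hp).1 (hS e he p hp))
  have hsm : ∀ e ∈ atlas (ℝ × ℝ) S, ∀ p ∈ e.source,
      ContDiffAt ℝ ∞ (fun x => (ψ (e.symm x) : ℍ[ℝ])) (e p) := fun e he p hp =>
    eventually_contDiffAt e.open_target (contDiffOn_of_isSolutionAt hg hK hKs h he)
      (e.map_source hp)
  have hψs : ContMDiff 𝓘(ℝ, ℝ × ℝ) 𝓘(ℝ, ℍ[ℝ]) ∞ fun p => (ψ p : ℍ[ℝ]) := fun p =>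
    contMDiffAt_of_comp_symm (chart_mem_atlas _ p) (mem_chart_source _ p)
      (hsm _ (chart_mem_atlas _ p) p (mem_chart_source _ p))
  refine ⟨fun p => (ψ p : ℍ[ℝ]) * sphereNormal (g p), ⟨hψs, fun p => ?_, fun p => ?_, fun p => ?_,
    fun p => ?_, fun e he p hp X => ?_⟩, fun e he p hp => ?_, fun p => ?_, fun e he p hp => ?_⟩
  · have := (hgeo _ (chart_mem_atlas _ p) p (mem_chart_source _ p)).1
    have e1 := mfderiv_eq_fderiv_chart ((hψs p).mdifferentiableAt (by simp))
    intro X Y hXY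
    exact this ((e1 X).symm.trans (hXY.trans (e1 Y)))
  · have he := chart_mem_atlas (ℝ × ℝ) p
    have hp := mem_chart_source (ℝ × ℝ) p
    exact contMDiffAt_of_comp_symm he hp
      ((hsm _ he p hp).mul (contDiffAt_chartNormal hg he hp))
  · rw [norm_mul, norm_coe_S3, one_mul, norm_eq_one_iff_inner, inner_sphereNormal_self]
  · have := inner_mul_mul_of_norm_one (norm_coe_S3 (ψ p)) 1 (sphereNormal (g p))
    rw [mul_one] at this
    rw [this, inner_eq_components]
    simp [sphereNormal_re]
  · have := (hgeo e he p hp).2.1 X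
    simpa only [chartNormal, e.left_inv hp] using this
  · obtain ⟨-, -, h11, h22, h12, hD, -⟩ := hgeo e he p hp
    refine ⟨h11, h22, h12, ?_⟩
    rw [hinv, inv_eq_star_of_norm_one (norm_coe_S3 _)]
    simpa only [chartNormal, e.left_inv hp] using hD
  · rw [gaussMap, hinv, stereo_sphereNormal]
  · refine (hgeo e he p hp).2.2.2.2.2.2.trans ?_
    rw [chartSqrt_sq hK, e.left_inv hp, neg_neg]

end Manifold

end LorentzGauss

end

/-! ### Both parts of the theorem; the first follows from the second by quantifying over `K`. -/

theorem mainTheorem11 {S : Type*} [TopologicalSpace S] [T2Space S] [SecondCountableTopology S]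
    [ChartedSpace (ℝ × ℝ) S] [LorentzGauss.LorentzSurface S] [SimplyConnectedSpace S]
    (g : S → OnePoint ℂ) (hg : LorentzGauss.SmoothToSphere g) :
    ((∃ (K : S → ℝ) (ψ : S → LorentzGauss.S3),
        (∀ p, K p < 0 ∧ K p ≠ -1) ∧ LorentzGauss.IsRealization g K ψ) ↔
      ∃ K : S → ℝ, ContMDiff 𝓘(ℝ, ℝ × ℝ) 𝓘(ℝ, ℝ) ∞ K ∧ (∀ p, K p < 0 ∧ K p ≠ -1) ∧
        LorentzGauss.SignCondition g K ∧ LorentzGauss.SolvesIntegrability g K) ∧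
    ∀ K : S → ℝ, (∀ p, K p < 0 ∧ K p ≠ -1) →
      ((∃ ψ : S → LorentzGauss.S3, LorentzGauss.IsRealization g K ψ) ↔
        ContMDiff 𝓘(ℝ, ℝ × ℝ) 𝓘(ℝ, ℝ) ∞ K ∧
          LorentzGauss.SignCondition g K ∧ LorentzGauss.SolvesIntegrability g K) ∧
      ∀ ψ₁ ψ₂ : S → LorentzGauss.S3,
        LorentzGauss.IsRealization g K ψ₁ → LorentzGauss.IsRealization g K ψ₂ →
          ∃ a : LorentzGauss.S3, ∀ p, ψ₂ p = a * ψ₁ p := by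
  have main : ∀ K : S → ℝ, (∀ p, K p < 0 ∧ K p ≠ -1) →
      ((∃ ψ : S → LorentzGauss.S3, LorentzGauss.IsRealization g K ψ) ↔
        ContMDiff 𝓘(ℝ, ℝ × ℝ) 𝓘(ℝ, ℝ) ∞ K ∧
          LorentzGauss.SignCondition g K ∧ LorentzGauss.SolvesIntegrability g K) := by
    intro K hK
    refine ⟨fun ⟨ψ, hψ⟩ => hψ.conditions hg hK, fun ⟨hKs, hS, hI⟩ => ?_⟩
    obtain ⟨ψ, hψ⟩ := LorentzGauss.exists_global_solution hg hK hKs hS hI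
    exact ⟨ψ, LorentzGauss.isRealization_of_isSolutionAt hg hK hKs hS hψ⟩
  refine ⟨⟨fun ⟨K, ψ, hK, hψ⟩ => ?_, fun ⟨K, hKs, hK, hS, hI⟩ => ?_⟩, fun K hK =>
    ⟨main K hK, fun ψ₁ ψ₂ h₁ h₂ => LorentzGauss.exists_left_translation hg hK
      (h₁.isSolutionAt hg hK).1 (h₂.isSolutionAt hg hK).1⟩⟩
  · obtain ⟨hKs, hS, hI⟩ := (main K hK).1 ⟨ψ, hψ⟩
    exact ⟨K, hKs, hK, hS, hI⟩
  · obtain ⟨ψ, hψ⟩ := (main K hK).2 ⟨hKs, hS, hI⟩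
    exact ⟨K, ψ, hK, hψ⟩
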